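/- **Setting.** A combinatorial auction has $n$ bidders and $m$ items; an allocation $x$ gives each item to at most one bidder, $x_i\subseteq[m]$ being the bundle of bidder $i$, who has a valuation $v_i:2^{[m]}\to\mathbb R_{\ge 0}$. A valuation $v$ is *XOS* if there are $a^\ell_j\ge 0$ with $v(S)=\max_\ell\sum_{j\in S}a^\ell_j$ for all $S$. It is *MPH-$k$* if $v(\emptyset)=0$ and there are $a^\ell_T\ge 0$ with $v(S)=\max_\ell\sum_{T\subseteq S,\,|T|\le k}a^\ell_T$ for all $S$. Let $\mathcal C$ be one of these classes. Bidders report valuations $b_i\in\mathcal C$. The *configuration LP* for $b$ is to maximize $\sum_i\sum_S b_i(S)x_{i,S}$ subject to $x_{i,S}\in[0,1]$, $\sum_i\sum_{S\ni j}x_{i,S}\le 1$ for every item $j$, and $\sum_S x_{i,S}\le 1$ for every bidder $i$. An *$\alpha$-approximate oblivious rounding scheme* ($\alpha\ge1$) maps each feasible $x'$ to a random allocation $x$, whose law depends on $x'$ only, such that $\mathbf E[w(x_i)]\ge\frac1\alpha\sum_S w(S)x'_{i,S}$ for every bidder $i$ and every $w\in\mathcal C$. The *pay-your-bid mechanism based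 on* such a scheme computes an optimal solution $x'$ of the configuration LP for the reported $b$, rounds it to an allocation $x=f(b)$, and charges bidder $i$ the amount $b_i(x_i)$ (with measurable choices throughout). Utilities are quasi-linear, $u_i(b,v_i)=\mathbf E[v_i(f_i(b))]-\mathbf E[b_i(f_i(b))]$. The *Price of Anarchy* $\mathrm{PoA}$ is the supremum, over all valuation profiles $v\in\mathcal C^n$ and all mixed Nash equilibria $b$ for $v$, of $\max_x\sum_i v_i(x_i)\,/\,\mathbf E[\sum_i v_i(f_i(b))]$. The *Bayesian Price of Anarchy* $\mathrm{BPoA}$ is the supremum, over all product distributions of the valuations on $\mathcal C^n$ and all mixed Bayes–Nash equilibria, of $\mathbf E[\max_x\sum_i v_i(x_i)]\,/\,\mathbf E[\sum_i v_i(f_i(b))]$. Here the ratios $0/0$ and $\infty/\infty$ are disregarded. **Theorem.** 1. For all $n,m$ there is, for XOS valuations, a pay-your-bid mechanism based on an $\frac{e}{e-1}$-approximate oblivious rounding scheme for the configuration LP with $\mathrm{PoA}\le 4\frac{e}{e-1}$ and $\mathrm{BPoA}\le 4\frac{e}{e-1}$. 2. There is a universal constant $c$ such that for all $k\ge 1$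 and all $n,m$ there is, for MPH-$k$ valuations, a pay-your-bid mechanism based on a $ck$-approximate oblivious rounding scheme for the configuration LP with $\mathrm{PoA}\le ck^2$ and $\mathrm{BPoA}\le ck^2$. -/

import Mathlib

open MeasureTheory ProbabilityTheory
open scoped NNReal ENNReal

noncomputable section

namespace CombAuction

/-- A set function on the bundles of `m` items, with values in `ℝ≥0`. -/
abbrev Valuation (m : ℕ) : Type := Finset (Fin m) → ℝ≥0

/-- XOS (fractionally subadditive) valuations: `v S = max_ℓ ∑_{j ∈ S} a ℓ j` with `a ℓ j ≥ 0`. -/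
def XOS (m : ℕ) : Set (Valuation m) :=
  {v | ∃ (ι : Type) (a : ι → Fin m → ℝ≥0),
    ∀ S, IsGreatest (Set.range fun ℓ => ∑ j ∈ S, a ℓ j) (v S)}

/-- Normalized MPH-`k` valuations: `v ∅ = 0` and
`v S = max_ℓ ∑_{T ⊆ S, |T| ≤ k} a ℓ T` with `a ℓ T ≥ 0`. -/
def MPH (m k : ℕ) : Set (Valuation m) :=
  {v | v ∅ = 0 ∧ ∃ (ι : Type) (a : ι → Finset (Fin m) → ℝ≥0),
    ∀ S, IsGreatest (Set.range fun ℓ => ∑ T ∈ S.powerset with T.card ≤ k, a ℓ T) (v S)}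

/-- An (integral) allocation: each item goes to at most one bidder. -/
@[ext] structure Allocation (n m : ℕ) where
  owner : Fin m → Option (Fin n)

instance (n m : ℕ) : MeasurableSpace (Allocation n m) := ⊤

/-- The set of items that bidder `i` receives. -/
def Allocation.bundle {n m : ℕ} (x : Allocation n m) (i : Fin n) : Finset (Fin m) :=
  Finset.univ.filter fun j => x.owner j = some i

/-! ### Mechanisms -/

/-- A randomized direct mechanism for bids in the class `C`: a (measurable) randomized outcome rule,
and payments that depend on the bids and the realized outcome. -/
structure Mechanism (n m : ℕ) (C : Set (Valuation m)) where
  outcome : Kernel (Fin n → C) (Allocation n m)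
  isMarkov : IsMarkovKernel outcome
  payment : (Fin n → C) → Allocation n m → Fin n → ℝ≥0
  measurable_payment : ∀ x i, Measurable fun b => payment b x i

/-- The pay-your-bid mechanism with a given outcome rule: bidder `i` pays his declared value
`b i` of the bundle that he receives. -/
def payYourBid {n m : ℕ} {C : Set (Valuation m)} (f : Kernel (Fin n → C) (Allocation n m))
    (hf : IsMarkovKernel f) : Mechanism n m C where
  outcome := f
  isMarkov := hf
  payment b x i := (b i : Valuation m) (x.bundle i)
  measurable_payment x i :=
    (measurable_pi_apply (x.bundle i)).comp (measurable_subtype_coe.comp (measurable_pi_apply i))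

section Equilibria

variable {n m : ℕ} {C : Set (Valuation m)}

/-- `E[v (f_i(b))]` for a bidder `i` with valuation `v`, the bid profile `b` having law `μ`. -/
def Mechanism.expValue (M : Mechanism n m C) (i : Fin n) (v : C) (μ : Measure (Fin n → C)) :
    ℝ≥0∞ :=
  ∫⁻ b, ∫⁻ x, ((v : Valuation m) (x.bundle i) : ℝ≥0∞) ∂(M.outcome b) ∂μ

/-- `E[p_i(b)]`, the bid profile `b` having law `μ`. -/
def Mechanism.expPayment (M : Mechanism n m C) (i : Fin n) (μ : Measure (Fin n → C)) : ℝ≥0∞ :=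
  ∫⁻ b, ∫⁻ x, (M.payment b x i : ℝ≥0∞) ∂(M.outcome b) ∂μ

/-- Expected quasi-linear utility `E[v (f_i(b))] - E[p_i(b)]`. For a probability measure `μ` the first
term is finite, so the difference is meaningful, with value `-∞` if the expected payment is infinite. -/
def Mechanism.expUtility (M : Mechanism n m C) (i : Fin n) (v : C) (μ : Measure (Fin n → C)) :
    EReal :=
  (M.expValue i v μ : EReal) - (M.expPayment i μ : EReal)

/-- The maximal social welfare of an allocation. -/
def optWelfare (v : Fin n → C) : ℝ≥0∞ :=
  ⨆ x : Allocation n m, ∑ i, ((v i : Valuation m) (x.bundle i) : ℝ≥0∞)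

/-- Mixed Nash equilibrium for the valuation profile `v`: the bids are independent, bidder `i` bids
according to `σ i`, and no bidder gains by switching to another random bid. -/
def Mechanism.IsMixedNash (M : Mechanism n m C) (v : Fin n → C)
    (σ : Fin n → ProbabilityMeasure C) : Prop :=
  ∀ (i : Fin n) (τ : ProbabilityMeasure C),
    M.expUtility i (v i) (Measure.pi (Function.update (fun j => (σ j : Measure C)) i τ)) ≤
      M.expUtility i (v i) (Measure.pi fun j => (σ j : Measure C))

/-- Price of Anarchy with respect to mixed Nash equilibria (in `ℝ≥0∞`, where `0 / 0 = 0`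
and `c / 0 = ∞` for `c > 0`). -/
def Mechanism.PoA (M : Mechanism n m C) : ℝ≥0∞ :=
  ⨆ (v : Fin n → C) (σ : Fin n → ProbabilityMeasure C) (_ : M.IsMixedNash v σ),
    optWelfare v / ∑ i, M.expValue i (v i) (Measure.pi fun j => (σ j : Measure C))

/-- Mixed Bayes-Nash equilibrium: the valuations are independent, `v i` has law `D i`; bidder `i`
with valuation `v i` bids according to `s i (v i)`. For almost every valuation `w` of bidder `i`,
given `w` and in expectation over the valuations and bids of the others, he does not gain by
switching to another random bid. The bid of bidder `j`, averaged over his valuation, has the law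
`(D j).bind (s j)`. -/
def Mechanism.IsMixedBayesNash (M : Mechanism n m C) (D : Fin n → ProbabilityMeasure C)
    (s : Fin n → Kernel C C) : Prop :=
  ∀ i : Fin n, ∀ᵐ w ∂(D i : Measure C), ∀ τ : ProbabilityMeasure C,
    M.expUtility i w
        (Measure.pi (Function.update (fun j => (D j : Measure C).bind (s j)) i τ)) ≤
      M.expUtility i w
        (Measure.pi (Function.update (fun j => (D j : Measure C).bind (s j)) i (s i w)))

/-- Expected social welfare when the pairs (valuation, bid) of the bidders are independent, the pair
of bidder `i` being drawn by `v i ∼ D i` and then `b i ∼ s i (v i)`. -/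
def Mechanism.bayesWelfare (M : Mechanism n m C) (D : Fin n → ProbabilityMeasure C)
    (s : Fin n → Kernel C C) : ℝ≥0∞ :=
  ∫⁻ q : Fin n → C × C,
      ∫⁻ x, ∑ i, (((q i).1 : Valuation m) (x.bundle i) : ℝ≥0∞) ∂(M.outcome fun i => (q i).2)
    ∂(Measure.pi fun i => (D i : Measure C) ⊗ₘ s i)

/-- Price of Anarchy with respect to mixed Bayes-Nash equilibria. -/
def Mechanism.BPoA (M : Mechanism n m C) : ℝ≥0∞ :=
  ⨆ (D : Fin n → ProbabilityMeasure C) (s : Fin n → Kernel C C)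
    (_ : ∀ i, IsMarkovKernel (s i)) (_ : M.IsMixedBayesNash D s),
    (∫⁻ v, optWelfare v ∂(Measure.pi fun i => (D i : Measure C))) / M.bayesWelfare D s

end Equilibria

/-! ### The configuration LP and oblivious rounding -/

/-- Feasible solutions of the configuration LP. -/
def ConfigLP (n m : ℕ) : Set (Fin n → Finset (Fin m) → ℝ≥0) :=
  {x | (∀ i S, x i S ≤ 1) ∧
    (∀ j : Fin m, ∑ i, ∑ S with j ∈ S, x i S ≤ 1) ∧
    (∀ i, ∑ S, x i S ≤ 1)}

/-- The value `∑_S v(S) x_{i,S}` of a fractional solution for bidder `i` with valuation `v`. -/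
def fracValue {n m : ℕ} (v : Valuation m) (i : Fin n) (x : ConfigLP n m) : ℝ≥0 :=
  ∑ S, v S * x.1 i S

/-- A (measurable) rule that maps each bid profile to an optimal solution of the configuration LP,
that is, to a fractional solution that maximizes the declared welfare. -/
structure IsExactSolver {n m : ℕ} {C : Set (Valuation m)}
    (f' : (Fin n → C) → ConfigLP n m) : Prop where
  measurable : Measurable f'
  optimal : ∀ (b : Fin n → C) (y : ConfigLP n m),
    ∑ i, fracValue (b i : Valuation m) i y ≤ ∑ i, fracValue (b i : Valuation m) i (f' b)

/-- `r` is an `α`-approximate oblivious rounding scheme for the class `C`: the law `r x` of the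
allocation depends on the fractional solution `x` only, and, whatever the valuations in `C` are,
each bidder's expected value is at least a `1/α` fraction of his value of `x`. -/
def IsObliviousRounding {n m : ℕ} (C : Set (Valuation m)) (α : ℝ)
    (r : Kernel (ConfigLP n m) (Allocation n m)) : Prop :=
  1 ≤ α ∧ ∀ (x : ConfigLP n m) (i : Fin n), ∀ w ∈ C,
    (fracValue w i x : ℝ≥0∞) ≤ ENNReal.ofReal α * ∫⁻ a, (w (a.bundle i) : ℝ≥0∞) ∂(r x)

/-- `M` is the pay-your-bid mechanism that solves the configuration LP exactly for the declared
valuations and rounds the solution by an `α`-approximate oblivious rounding scheme. -/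
def IsPayYourBidObliviousRounding {n m : ℕ} {C : Set (Valuation m)} (α : ℝ)
    (M : Mechanism n m C) : Prop :=
  ∃ (f' : (Fin n → C) → ConfigLP n m) (hf' : IsExactSolver f')
    (r : Kernel (ConfigLP n m) (Allocation n m)) (_ : IsMarkovKernel r),
    IsObliviousRounding C α r ∧ M = payYourBid (r.comap f' hf'.measurable) inferInstance

end CombAuction

end

/-!
The mechanisms behind the theorem solve the configuration LP exactly and round its solution
obliviously. Two facts are combined: a smoothness inequality for the fractional pay-your-bid
mechanism, which survives the rounding at the loss of a factor `α`, and explicit rounding schemes.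

**Smoothness.** Let bidder `i` deviate to `v i / 2`, a bid that ignores the valuations and the bids of
the others, and let `a` be any allocation. Moving `a`'s bundle of bidder `i` to him and deleting its
items from the bundles of the others keeps the LP solution feasible (`reassign`), so the optimality
of the LP solution at the deviation bounds the deviator's fractional value from below. Deleting the
disjoint bundles of `a` one after the other costs in total at most `k` times the declared welfare
when the bids are MPH-`k` (`MPH.sum_sdiff_bundle`), and XOS valuations are MPH-`1`. Summing over the
bidders gives `IsExactSolver.smooth`. Since rounding keeps a `1/α` fraction of every bidder's value,
of his deviation as well as of his declared value, the same holds for the rounded mechanism up to `α`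
(`optWelfare_le_of_rounding`). In equilibrium the payment of a bidder plus half of the value brought by
his deviation is at most his value (`expPayment_add_half_le`); averaging over independent valuations
and bids yields `BPoA ≤ 2 (k + 1) α` (`BPoA_le_of_rounding`). The deviation does not depend on the
other valuations, so no separate argument for incomplete information is needed, and Nash
equilibria are Bayes-Nash equilibria for point masses (`Mechanism.PoA_le_BPoA`).

**Measurable optimal solutions.** The LP has finitely many patterns of active constraints, and a
feasible point with the same pattern as an optimal solution is itself optimal. One representative of
each pattern therefore suffices for all bids, and the first optimal one is a measurable choice
(`exists_isExactSolver`).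

**Rounding.** Every bidder requests a random bundle drawn from his part of the LP solution. For MPH-`k`
the requests are scaled down by `1 / (2k)` and an item is given to its only requester; by a union bound
a set of at most `k` requested items survives with probability at least `1/2`
(`exists_rounding_MPH`). For XOS an item with requesters `A` is given to the one whose clock rings
first, where the clock of a bidder who requests it with probability `p` rings with density `e^{-sp}`
given the request. Without conditioning, the bidder is silent until time `t` with
probability `e^{-tp}`, so a requester wins with probability
`∫₀¹ e^{-t ∑ p} dt ≥ 1 - 1/e` (`le_sum_request_winProb`, `exists_rounding_XOS`).
-/

namespace CombAuction

variable {n m k : ℕ} {C : Set (Valuation m)}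

/-! ### XOS and MPH valuations -/

lemma XOS.exists_support {v : Valuation m} (hv : v ∈ XOS m) (S : Finset (Fin m)) :
    ∃ a : Fin m → ℝ≥0, v S = ∑ j ∈ S, a j ∧ ∀ U, ∑ j ∈ U, a j ≤ v U := by
  obtain ⟨ι, a, h⟩ := hv
  obtain ⟨ℓ, hℓ⟩ := (h S).1
  exact ⟨a ℓ, hℓ.symm, fun U => (h U).2 ⟨ℓ, rfl⟩⟩

lemma MPH.exists_support {v : Valuation m} (hv : v ∈ MPH m k) (S : Finset (Fin m)) :
    ∃ a : Finset (Fin m) → ℝ≥0, v S = ∑ T ∈ S.powerset with T.card ≤ k, a T ∧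
      ∀ U, ∑ T ∈ U.powerset with T.card ≤ k, a T ≤ v U := by
  obtain ⟨-, ι, a, h⟩ := hv
  obtain ⟨ℓ, hℓ⟩ := (h S).1
  exact ⟨a ℓ, hℓ.symm, fun U => (h U).2 ⟨ℓ, rfl⟩⟩

lemma MPH.monotone {v : Valuation m} (hv : v ∈ MPH m k) : Monotone v := by
  intro S U hSU
  obtain ⟨a, haS, ha⟩ := MPH.exists_support hv S
  rw [haS]
  refine le_trans (Finset.sum_le_sum_of_subset ?_) (ha U)
  exact Finset.filter_subset_filter _ (Finset.powerset_mono.2 hSU)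

lemma XOS_subset_MPH_one : XOS m ⊆ MPH m 1 := by
  rintro v ⟨ι, a, h⟩
  have key : ∀ (S : Finset (Fin m)) (ℓ : ι),
      ∑ T ∈ S.powerset with T.card ≤ 1, (if T.card = 1 then ∑ j ∈ T, a ℓ j else 0)
        = ∑ j ∈ S, a ℓ j := by
    intro S ℓ
    rw [← Finset.sum_filter, Finset.filter_filter]
    have : S.powerset.filter (fun T => T.card ≤ 1 ∧ T.card = 1) = S.powersetCard 1 := by
      ext T
      simp only [Finset.mem_filter, Finset.mem_powerset, Finset.mem_powersetCard]
      constructor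
      · rintro ⟨h1, -, h2⟩; exact ⟨h1, h2⟩
      · rintro ⟨h1, h2⟩; exact ⟨h1, h2.le, h2⟩
    rw [this, Finset.powersetCard_one]
    simp
  refine ⟨?_, ι, fun ℓ T => if T.card = 1 then ∑ j ∈ T, a ℓ j else 0, fun S => ?_⟩
  · obtain ⟨ℓ, hℓ⟩ := (h ∅).1
    simpa using hℓ.symm
  · simpa only [key] using h S

/-- The valuation `v / 2`, the bid that serves as the deviation in the smoothness argument. -/
noncomputable def halve (v : Valuation m) : Valuation m := fun S => v S / 2

lemma halve_mem_XOS {v : Valuation m} (hv : v ∈ XOS m) : halve v ∈ XOS m := by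
  obtain ⟨ι, a, h⟩ := hv
  refine ⟨ι, fun ℓ j => a ℓ j / 2, fun S => ⟨?_, ?_⟩⟩
  · obtain ⟨ℓ, hℓ⟩ := (h S).1
    exact ⟨ℓ, by simp only [halve, ← hℓ, Finset.sum_div]⟩
  · rintro _ ⟨ℓ, rfl⟩
    simp only [halve, ← Finset.sum_div]
    gcongr
    exact (h S).2 ⟨ℓ, rfl⟩

lemma halve_mem_MPH {v : Valuation m} (hv : v ∈ MPH m k) : halve v ∈ MPH m k := by
  obtain ⟨h0, ι, a, h⟩ := hv
  refine ⟨by simp [halve, h0], ι, fun ℓ j => a ℓ j / 2, fun S => ⟨?_, ?_⟩⟩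
  · obtain ⟨ℓ, hℓ⟩ := (h S).1
    exact ⟨ℓ, by simp only [halve, ← hℓ, Finset.sum_div]⟩
  · rintro _ ⟨ℓ, rfl⟩
    simp only [halve, ← Finset.sum_div]
    gcongr
    exact (h S).2 ⟨ℓ, rfl⟩

/-- A set of at most `k` items meets at most `k` bundles of an allocation. -/
lemma Allocation.le_add_card_disjoint (x : Allocation n m) {T : Finset (Fin m)}
    (hT : T.card ≤ k) :
    n ≤ k + (Finset.univ.filter fun i => Disjoint T (x.bundle i)).card := by
  have h1 : (Finset.univ.filter fun i => ¬ Disjoint T (x.bundle i)).card ≤ T.card := by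
    have hsub : (Finset.univ.filter fun i => ¬ Disjoint T (x.bundle i)).image some
        ⊆ T.image x.owner := by
      intro o ho
      simp only [Finset.mem_image, Finset.mem_filter, Finset.mem_univ, true_and,
        Finset.not_disjoint_iff] at ho
      obtain ⟨i, ⟨j, hj, hji⟩, rfl⟩ := ho
      exact Finset.mem_image.2 ⟨j, hj, by simpa [Allocation.bundle] using hji⟩
    have := (Finset.card_le_card hsub).trans Finset.card_image_le
    rwa [Finset.card_image_of_injective _ (Option.some_injective _)] at this
  have h2 := Finset.card_filter_add_card_filter_not (s := (Finset.univ : Finset (Fin n)))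
    (fun i => Disjoint T (x.bundle i))
  simp only [Finset.card_univ, Fintype.card_fin] at h2
  omega

/-- Removing the bundles of an allocation one at a time destroys, in total, at most `k` times the
value of a bundle: in the representation of `v U`, a set `T` of at most `k` items is hit by at most
`k` of the bundles. -/
lemma MPH.sum_sdiff_bundle {v : Valuation m} (hv : v ∈ MPH m k) (x : Allocation n m)
    (U : Finset (Fin m)) :
    n * v U ≤ k * v U + ∑ i, v (U \ x.bundle i) := by
  obtain ⟨a, haU, ha⟩ := MPH.exists_support hv U
  have h1 : ∀ i, ∑ T ∈ U.powerset with T.card ≤ k,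
      (if Disjoint T (x.bundle i) then a T else 0) ≤ v (U \ x.bundle i) := by
    intro i
    refine le_trans (le_of_eq ?_) (ha (U \ x.bundle i))
    rw [← Finset.sum_filter, Finset.filter_filter]
    refine Finset.sum_congr ?_ fun _ _ => rfl
    ext T
    simp only [Finset.mem_filter, Finset.mem_powerset, Finset.subset_sdiff]
    tauto
  calc (n : ℝ≥0) * v U
      = ∑ T ∈ U.powerset with T.card ≤ k, (n : ℝ≥0) * a T := by rw [haU, Finset.mul_sum]
    _ ≤ ∑ T ∈ U.powerset with T.card ≤ k,
          (k * a T + ∑ i, if Disjoint T (x.bundle i) then a T else 0) := by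
        refine Finset.sum_le_sum fun T hT => ?_
        have hn : (n : ℝ≥0) ≤ k + ((Finset.univ.filter
            fun i => Disjoint T (x.bundle i)).card : ℕ) := by
          exact_mod_cast x.le_add_card_disjoint (Finset.mem_filter.1 hT).2
        rw [← Finset.sum_filter, Finset.sum_const, nsmul_eq_mul, ← add_mul]
        gcongr
    _ = k * v U + ∑ i, ∑ T ∈ U.powerset with T.card ≤ k,
          (if Disjoint T (x.bundle i) then a T else 0) := by
        rw [Finset.sum_add_distrib, ← Finset.mul_sum, ← haU, Finset.sum_comm]
    _ ≤ _ := by gcongr with i; exact h1 i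

/-! ### Optimal solutions of the configuration LP -/

lemma isCompact_ConfigLP (n m : ℕ) : IsCompact (ConfigLP n m) := by
  have hc : IsCompact (Set.univ.pi fun _ : Fin n => Set.univ.pi fun _ : Finset (Fin m) =>
      Set.Icc (0 : ℝ≥0) 1) :=
    isCompact_univ_pi fun _ => isCompact_univ_pi fun _ => isCompact_Icc
  refine hc.of_isClosed_subset ?_ fun x hx => ?_
  · have : ConfigLP n m = (⋂ i, ⋂ S, {x | x i S ≤ 1}) ∩
        ((⋂ j, {x | ∑ i, ∑ S with j ∈ S, x i S ≤ 1}) ∩ ⋂ i, {x | ∑ S, x i S ≤ 1}) := by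
      ext x; simp [ConfigLP]
    rw [this]
    refine IsClosed.inter (isClosed_iInter fun i => isClosed_iInter fun S => ?_)
      (IsClosed.inter (isClosed_iInter fun i => ?_) (isClosed_iInter fun i => ?_)) <;>
    exact isClosed_le (by fun_prop) (by fun_prop)
  · simp only [Set.mem_pi, Set.mem_univ, true_implies, Set.mem_Icc]
    exact fun i S => ⟨zero_le, hx.1 i S⟩

instance : Nonempty (ConfigLP n m) := ⟨⟨0, by simp [ConfigLP]⟩⟩

lemma exists_optimal (v : Fin n → Valuation m) :
    ∃ x : ConfigLP n m, ∀ y : ConfigLP n m,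
      ∑ i, fracValue (v i) i y ≤ ∑ i, fracValue (v i) i x := by
  have : CompactSpace (ConfigLP n m) := isCompact_iff_compactSpace.1 (isCompact_ConfigLP n m)
  have hcont : Continuous fun x : ConfigLP n m => ∑ i, fracValue (v i) i x := by
    have (i : Fin n) (S : Finset (Fin m)) : Continuous fun x : ConfigLP n m => x.1 i S :=
      (continuous_apply_apply i S).comp continuous_subtype_val
    exact continuous_finsetSum _ fun i _ => continuous_finsetSum _ fun S _ =>
      continuous_const.mul (this i S)
  obtain ⟨x, -, hx⟩ := isCompact_univ.exists_isMaxOn Set.univ_nonempty hcont.continuousOn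
  exact ⟨x, fun y => hx (Set.mem_univ y)⟩

/-- The constraints of the configuration LP that are active at `x`: the vanishing variables, and
the items and bidders whose constraint is tight. The constraints `x i S ≤ 1` follow from the
others. -/
def activeSet (x : ConfigLP n m) : Set (Fin n × Finset (Fin m)) × Set (Fin m) × Set (Fin n) :=
  ({p | x.1 p.1 p.2 = 0}, {j | ∑ i, ∑ S with j ∈ S, x.1 i S = 1}, {i | ∑ S, x.1 i S = 1})

/-- A tight constraint stays tight and a slack one stays satisfied a little way beyond `a` on
the line from `b` through `a`. -/
lemma eventually_extrapolate_le_one {a b : ℝ} (ha : a ≤ 1) (h : a = 1 → b = 1) :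
    ∀ᶠ t : ℝ in nhdsWithin 0 (Set.Ioi 0), a + t * (a - b) ≤ 1 := by
  rcases ha.eq_or_lt with rfl | ha
  · simp [h rfl]
  · have : Filter.Tendsto (fun t : ℝ => a + t * (a - b)) (nhdsWithin 0 (Set.Ioi 0)) (nhds a) := by
      have : Continuous fun t : ℝ => a + t * (a - b) := by fun_prop
      simpa using (this.tendsto 0).mono_left nhdsWithin_le_nhds
    exact this.eventually_le_const ha

lemma eventually_extrapolate_nonneg {a b : ℝ} (ha : 0 ≤ a) (h : a = 0 → b = 0) :
    ∀ᶠ t : ℝ in nhdsWithin 0 (Set.Ioi 0), 0 ≤ a + t * (a - b) := by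
  have := eventually_extrapolate_le_one (a := 1 - a) (b := 1 - b) (by linarith)
    (fun h' => by linarith [h (by linarith)])
  filter_upwards [this] with t ht
  linarith

/-- A feasible point with the same active constraints as an optimal solution is optimal:
otherwise, moving from it through the optimal solution and a little beyond would stay feasible
and improve the objective. -/
lemma optimal_of_activeSet_eq {v : Fin n → Valuation m} {x y : ConfigLP n m}
    (hx : ∀ z : ConfigLP n m, ∑ i, fracValue (v i) i z ≤ ∑ i, fracValue (v i) i x)
    (hxy : activeSet x = activeSet y) :
    ∑ i, fracValue (v i) i x ≤ ∑ i, fracValue (v i) i y := by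
  simp only [activeSet, Prod.mk.injEq, Set.ext_iff, Set.mem_ofPred_eq, Prod.forall] at hxy
  obtain ⟨h0, hj, hi⟩ := hxy
  have e1 : ∀ᶠ t : ℝ in nhdsWithin 0 (Set.Ioi 0), ∀ (i : Fin n) (S : Finset (Fin m)),
      0 ≤ (x.1 i S : ℝ) + t * (x.1 i S - y.1 i S) := by
    refine Filter.eventually_all.2 fun i => Filter.eventually_all.2 fun S =>
      eventually_extrapolate_nonneg (x.1 i S).2 fun h => ?_
    exact_mod_cast (h0 i S).1 (by exact_mod_cast h)
  have e2 : ∀ᶠ t : ℝ in nhdsWithin 0 (Set.Ioi 0), ∀ j : Fin m,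
      (∑ i, ∑ S with j ∈ S, x.1 i S : ℝ≥0) + t * ((∑ i, ∑ S with j ∈ S, x.1 i S : ℝ≥0)
        - (∑ i, ∑ S with j ∈ S, y.1 i S : ℝ≥0)) ≤ (1 : ℝ) := by
    refine Filter.eventually_all.2 fun j =>
      eventually_extrapolate_le_one (by exact_mod_cast x.2.2.1 j) fun h => ?_
    exact_mod_cast (hj j).1 (by exact_mod_cast h)
  have e3 : ∀ᶠ t : ℝ in nhdsWithin 0 (Set.Ioi 0), ∀ i : Fin n,
      (∑ S, x.1 i S : ℝ≥0) + t * ((∑ S, x.1 i S : ℝ≥0) - (∑ S, y.1 i S : ℝ≥0)) ≤ (1 : ℝ) := by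
    refine Filter.eventually_all.2 fun i =>
      eventually_extrapolate_le_one (by exact_mod_cast x.2.2.2 i) fun h => ?_
    exact_mod_cast (hi i).1 (by exact_mod_cast h)
  obtain ⟨t, ⟨⟨ht1, ht2⟩, ht3⟩, ht⟩ := (((e1.and e2).and e3).and self_mem_nhdsWithin).exists
  have ht : 0 < t := ht
  let z : Fin n → Finset (Fin m) → ℝ≥0 :=
    fun i S => ⟨(x.1 i S : ℝ) + t * (x.1 i S - y.1 i S), ht1 i S⟩
  have hz : ∀ i S, (z i S : ℝ) = x.1 i S + t * (x.1 i S - y.1 i S) := fun _ _ => rfl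
  have hz3 : ∀ i, ∑ S, z i S ≤ 1 := by
    intro i
    have := ht3 i
    rw [← NNReal.coe_le_coe]
    push_cast at this ⊢
    simpa only [hz, Finset.sum_add_distrib, ← Finset.mul_sum, Finset.sum_sub_distrib] using this
  have hzmem : z ∈ ConfigLP n m := by
    refine ⟨fun i S => ?_, fun j => ?_, hz3⟩
    · exact (Finset.single_le_sum (fun _ _ => zero_le) (Finset.mem_univ S)).trans (hz3 i)
    · have := ht2 j
      rw [← NNReal.coe_le_coe]
      push_cast at this ⊢
      simpa only [hz, Finset.sum_add_distrib, ← Finset.mul_sum, Finset.sum_sub_distrib] using this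
  have hle := hx ⟨z, hzmem⟩
  have key : ((∑ i, fracValue (v i) i ⟨z, hzmem⟩ : ℝ≥0) : ℝ)
      = (∑ i, fracValue (v i) i x : ℝ≥0) + t * ((∑ i, fracValue (v i) i x : ℝ≥0)
        - (∑ i, fracValue (v i) i y : ℝ≥0)) := by
    simp only [fracValue, NNReal.coe_sum, NNReal.coe_mul, hz, mul_add, Finset.sum_add_distrib,
      mul_sub, Finset.sum_sub_distrib, Finset.mul_sum]
    congr 2 <;> refine Finset.sum_congr rfl fun i _ => Finset.sum_congr rfl fun S _ => by ring
  rw [← NNReal.coe_le_coe] at hle ⊢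
  rw [key] at hle
  by_contra hlt
  push Not at hlt
  nlinarith [mul_pos ht (sub_pos.2 hlt)]

/-- Finitely many feasible points suffice to solve the configuration LP for all objectives. -/
lemma exists_finite_optimal (n m : ℕ) : ∃ F : Set (ConfigLP n m), F.Finite ∧ F.Nonempty ∧
    ∀ v : Fin n → Valuation m, ∃ x ∈ F, ∀ y : ConfigLP n m,
      ∑ i, fracValue (v i) i y ≤ ∑ i, fracValue (v i) i x := by
  refine ⟨Set.range fun p : Set.range (activeSet (n := n) (m := m)) => p.2.choose,
    Set.finite_range _, Set.range_nonempty _, fun v => ?_⟩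
  obtain ⟨x, hx⟩ := exists_optimal v
  have hp : activeSet x ∈ Set.range (activeSet (n := n) (m := m)) := ⟨x, rfl⟩
  exact ⟨_, ⟨⟨_, hp⟩, rfl⟩,
    fun y => (hx y).trans (optimal_of_activeSet_eq hx hp.choose_spec.symm)⟩

open Classical in
lemma exists_isExactSolver (n : ℕ) {m : ℕ} (C : Set (Valuation m)) :
    ∃ f' : (Fin n → C) → ConfigLP n m, IsExactSolver f' := by
  obtain ⟨F, hF, hne, hopt⟩ := exists_finite_optimal n m
  obtain ⟨y, rfl⟩ := hF.countable.exists_eq_range hne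
  let W : (Fin n → C) → ConfigLP n m → ℝ≥0 := fun b x => ∑ i, fracValue (b i : Valuation m) i x
  have hW : ∀ x, Measurable fun b => W b x := by
    intro x
    simp only [W, fracValue]
    refine Finset.measurable_sum _ fun i _ => Finset.measurable_sum _ fun S _ => ?_
    exact ((measurable_pi_apply S).comp
      (measurable_subtype_coe.comp (measurable_pi_apply i))).mul_const _
  have hex : ∀ b, ∃ N, ∀ M, W b (y M) ≤ W b (y N) := by
    intro b
    obtain ⟨_, ⟨N, rfl⟩, hN⟩ := hopt fun i => (b i : Valuation m)
    exact ⟨N, fun M => hN (y M)⟩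
  have hmeas : ∀ N, MeasurableSet {b | ∀ M, W b (y M) ≤ W b (y N)} := by
    intro N
    rw [Set.ofPred_forall]
    exact MeasurableSet.iInter fun M => measurableSet_le (hW _) (hW _)
  refine ⟨fun b => y (Nat.find (hex b)),
    measurable_from_nat.comp (measurable_find hex hmeas), fun b z => ?_⟩
  obtain ⟨_, ⟨N, rfl⟩, hN⟩ := hopt fun i => (b i : Valuation m)
  exact (hN z).trans (Nat.find_spec (hex b) N)

/-! ### Smoothness of the fractional pay-your-bid mechanism -/

/-- The fractional solution obtained from `x` by giving bidder `i` his bundle in the allocation `a`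
and taking these items away from the others. -/
noncomputable def reassign (x : ConfigLP n m) (a : Allocation n m) (i : Fin n) : ConfigLP n m :=
  let y : Fin n → Finset (Fin m) → ℝ≥0 := fun l S =>
    if l = i then (if S = a.bundle i then 1 else 0) else ∑ U with U \ a.bundle i = S, x.1 l U
  have h3 : ∀ l, ∑ S, y l S ≤ 1 := by
    intro l
    by_cases h : l = i
    · simp [y, h]
    · simp only [y, h, if_false]
      rw [Finset.sum_fiberwise]
      exact x.2.2.2 l
  ⟨y, fun l S => (Finset.single_le_sum (fun _ _ => zero_le) (Finset.mem_univ S)).trans (h3 l),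
    by
      intro j
      by_cases hj : j ∈ a.bundle i
      · rw [Finset.sum_eq_single i]
        · simp only [y, if_true]
          rw [Finset.sum_ite_eq']
          split_ifs <;> simp
        · intro l _ h
          simp only [y, h, if_false]
          refine Finset.sum_eq_zero fun S hS => Finset.sum_eq_zero fun U hU => ?_
          simp only [Finset.mem_filter, Finset.mem_univ, true_and] at hS hU
          subst hU
          exact absurd hj (Finset.mem_sdiff.1 hS).2
        · simp
      · refine le_trans (Finset.sum_le_sum fun l _ => ?_) (x.2.2.1 j)
        by_cases h : l = i
        · simp only [y, h, if_true]
          rw [Finset.sum_ite_eq', if_neg (by simpa using hj)]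
          exact zero_le
        · simp only [y, h, if_false]
          rw [Finset.sum_fiberwise_eq_sum_filter]
          refine Finset.sum_le_sum_of_subset fun U hU => ?_
          simp only [Finset.mem_filter, Finset.mem_univ, true_and, Finset.mem_sdiff] at hU ⊢
          exact hU.1,
    h3⟩

lemma fracValue_reassign_self (v : Valuation m) (x : ConfigLP n m) (a : Allocation n m)
    (i : Fin n) : fracValue v i (reassign x a i) = v (a.bundle i) := by
  simp [fracValue, reassign]

lemma fracValue_reassign_of_ne (v : Valuation m) (x : ConfigLP n m) (a : Allocation n m)
    {i l : Fin n} (h : l ≠ i) :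
    fracValue v l (reassign x a i) = ∑ U, v (U \ a.bundle i) * x.1 l U := by
  simp only [fracValue, reassign, h, if_false, Finset.mul_sum]
  rw [← Finset.sum_fiberwise (s := Finset.univ) (g := fun U => U \ a.bundle i)
    (f := fun U => v (U \ a.bundle i) * x.1 l U)]
  refine Finset.sum_congr rfl fun S _ => Finset.sum_congr rfl fun U hU => ?_
  rw [(Finset.mem_filter.1 hU).2]

/-- Smoothness: if each bidder in turn deviates to half of his valuation, the fractional values that
the deviators receive, together with the declared welfare, cover the welfare of any
allocation `a`. -/
lemma IsExactSolver.smooth {f' : (Fin n → C) → ConfigLP n m} (hf' : IsExactSolver f')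
    (hC : C ⊆ MPH m k) (hh : ∀ v ∈ C, halve v ∈ C) (v b : Fin n → C) (a : Allocation n m) :
    ∑ i, (v i : Valuation m) (a.bundle i) / 2 ≤
      ∑ i, fracValue (v i : Valuation m) i
          (f' (Function.update b i ⟨halve (v i), hh _ (v i).2⟩)) / 2
        + (k + 1) * ∑ i, fracValue (b i : Valuation m) i (f' b) := by
  set x := f' b with hx
  set W := ∑ i, fracValue (b i : Valuation m) i x with hW
  -- optimality at the deviation of bidder `i`, compared with the reassigned solution
  have hdev : ∀ i, (v i : Valuation m) (a.bundle i) / 2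
      + ∑ l ∈ Finset.univ.erase i, ∑ U, (b l : Valuation m) (U \ a.bundle i) * x.1 l U
      ≤ fracValue (v i : Valuation m) i
          (f' (Function.update b i ⟨halve (v i), hh _ (v i).2⟩)) / 2 + W := by
    intro i
    set b' := Function.update b i ⟨halve (v i), hh _ (v i).2⟩ with hb'
    have hopt := hf'.optimal b' (reassign x a i)
    have hsplit : ∀ y : ConfigLP n m, ∑ l, fracValue (b' l : Valuation m) l y
        = fracValue (v i : Valuation m) i y / 2
          + ∑ l ∈ Finset.univ.erase i, fracValue (b l : Valuation m) l y := by
      intro y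
      rw [← Finset.add_sum_erase _ _ (Finset.mem_univ i)]
      congr 1
      · simp only [hb', Function.update_self, fracValue, halve, Finset.sum_div]
        exact Finset.sum_congr rfl fun S _ => by ring
      · refine Finset.sum_congr rfl fun l hl => ?_
        rw [hb', Function.update_of_ne (Finset.ne_of_mem_erase hl)]
    rw [hsplit, hsplit, fracValue_reassign_self] at hopt
    have e : ∑ l ∈ Finset.univ.erase i, fracValue (b l : Valuation m) l (reassign x a i)
        = ∑ l ∈ Finset.univ.erase i, ∑ U, (b l : Valuation m) (U \ a.bundle i) * x.1 l U :=
      Finset.sum_congr rfl fun l hl => fracValue_reassign_of_ne _ _ _ (Finset.ne_of_mem_erase hl)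
    rw [e] at hopt
    refine hopt.trans (add_le_add le_rfl ?_)
    refine le_trans ?_ (hf'.optimal b (f' b'))
    exact Finset.sum_le_sum_of_subset (Finset.erase_subset _ _)
  -- what the others lose when their bundles are cut down, summed over the deviators
  have hloss : n * W ≤ (k + 1) * W
      + ∑ i, ∑ l ∈ Finset.univ.erase i, ∑ U, (b l : Valuation m) (U \ a.bundle i) * x.1 l U := by
    have h1 : n * W ≤ k * W
        + ∑ i, ∑ l, ∑ U, (b l : Valuation m) (U \ a.bundle i) * x.1 l U := by
      rw [Finset.sum_comm, hW, Finset.mul_sum, Finset.mul_sum, ← Finset.sum_add_distrib]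
      refine Finset.sum_le_sum fun l _ => ?_
      rw [Finset.sum_comm, fracValue, Finset.mul_sum, Finset.mul_sum, ← Finset.sum_add_distrib]
      refine Finset.sum_le_sum fun U _ => ?_
      rw [← Finset.sum_mul, ← mul_assoc, ← mul_assoc, ← add_mul]
      gcongr
      exact MPH.sum_sdiff_bundle (hC (b l).2) a U
    have h2 : ∑ i, ∑ l, ∑ U, (b l : Valuation m) (U \ a.bundle i) * x.1 l U
        ≤ W + ∑ i, ∑ l ∈ Finset.univ.erase i,
          ∑ U, (b l : Valuation m) (U \ a.bundle i) * x.1 l U := by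
      rw [hW, ← Finset.sum_add_distrib]
      refine Finset.sum_le_sum fun i _ => ?_
      rw [← Finset.add_sum_erase _ _ (Finset.mem_univ i)]
      gcongr
      refine Finset.sum_le_sum fun U _ => ?_
      gcongr
      exact MPH.monotone (hC (b i).2) Finset.sdiff_subset
    calc n * W ≤ _ := h1
      _ ≤ k * W + (W + _) := by gcongr
      _ = _ := by ring
  have hsum := Finset.sum_le_sum fun i (_ : i ∈ (Finset.univ : Finset (Fin n))) => hdev i
  rw [Finset.sum_add_distrib, Finset.sum_add_distrib, Finset.sum_const, Finset.card_univ,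
    Fintype.card_fin, nsmul_eq_mul] at hsum
  rw [← NNReal.coe_le_coe] at hsum hloss ⊢
  simp only [NNReal.coe_add, NNReal.coe_mul, NNReal.coe_natCast, NNReal.coe_one] at *
  linarith

/-! ### Expected values and payments in a mechanism -/

instance : Finite (Allocation n m) :=
  Finite.of_injective Allocation.owner fun _ _ h => Allocation.ext h

noncomputable instance : Fintype (Allocation n m) := Fintype.ofFinite _

instance : DiscreteMeasurableSpace (Allocation n m) := ⟨fun _ => trivial⟩

/-- Resampling the coordinate `i` of a product measure from `ν`. -/
lemma lintegral_pi_update {ι X : Type*} [Fintype ι] [DecidableEq ι] [MeasurableSpace X]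
    (μ : ι → Measure X) [∀ i, IsProbabilityMeasure (μ i)] (i : ι) (ν : Measure X)
    [IsProbabilityMeasure ν] {F : (ι → X) → ℝ≥0∞} (hF : Measurable F) :
    ∫⁻ b, F b ∂Measure.pi (Function.update μ i ν)
      = ∫⁻ y, ∫⁻ b, F (Function.update b i y) ∂Measure.pi μ ∂ν := by
  have hinst : ∀ j, IsProbabilityMeasure (Function.update μ i ν j) := by
    intro j
    rcases eq_or_ne j i with rfl | h
    · rwa [Function.update_self]
    · rw [Function.update_of_ne h]; infer_instance
  have hu : Measurable fun p : X × (ι → X) => Function.update p.2 i p.1 :=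
    measurable_update'.comp measurable_swap
  have hpi : Measure.pi (Function.update μ i ν)
      = (ν.prod (Measure.pi μ)).map fun p => Function.update p.2 i p.1 := by
    refine Measure.pi_eq fun s hs => ?_
    have hpre : (fun p : X × (ι → X) => Function.update p.2 i p.1) ⁻¹' Set.univ.pi s
        = s i ×ˢ Set.univ.pi (Function.update s i Set.univ) := by
      ext ⟨y, b⟩
      simp only [Set.mem_preimage, Set.mem_pi, Set.mem_univ, true_implies, Set.mem_prod]
      constructor
      · refine fun h => ⟨by simpa using h i, fun j => ?_⟩
        rcases eq_or_ne j i with rfl | hj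
        · simp
        · simpa [hj] using h j
      · rintro ⟨h1, h2⟩ j
        rcases eq_or_ne j i with rfl | hj
        · simpa using h1
        · simpa [hj] using h2 j
    rw [Measure.map_apply hu (MeasurableSet.univ_pi hs), hpre, Measure.prod_prod, Measure.pi_pi,
      ← Finset.mul_prod_erase _ _ (Finset.mem_univ i),
      ← Finset.mul_prod_erase Finset.univ (fun j => Function.update μ i ν j (s j))
        (Finset.mem_univ i)]
    simp only [Function.update_self, measure_univ, one_mul]
    congr 1
    refine Finset.prod_congr rfl fun j hj => ?_
    rw [Function.update_of_ne (Finset.ne_of_mem_erase hj),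
      Function.update_of_ne (Finset.ne_of_mem_erase hj)]
  rw [hpi, lintegral_map hF hu]
  exact lintegral_prod _ (hF.comp hu).aemeasurable

namespace Mechanism

variable (M : Mechanism n m C)

/-- `E[w (f_i(b))]` for a fixed bid profile `b`. -/
noncomputable def value (i : Fin n) (w : C) (b : Fin n → C) : ℝ≥0∞ :=
  ∫⁻ x, ((w : Valuation m) (x.bundle i) : ℝ≥0∞) ∂(M.outcome b)

/-- `E[p_i(b)]` for a fixed bid profile `b`. -/
noncomputable def pay (i : Fin n) (b : Fin n → C) : ℝ≥0∞ :=
  ∫⁻ x, (M.payment b x i : ℝ≥0∞) ∂(M.outcome b)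

lemma measurable_outcome_apply (x : Allocation n m) : Measurable fun b => M.outcome b {x} :=
  Kernel.measurable_coe _ (measurableSet_singleton x)

lemma measurable_value (i : Fin n) :
    Measurable fun p : C × (Fin n → C) => M.value i p.1 p.2 := by
  simp only [value, lintegral_fintype]
  refine Finset.measurable_sum _ fun x _ => Measurable.mul ?_ ?_
  · exact ((measurable_pi_apply (x.bundle i)).comp
      (measurable_subtype_coe.comp measurable_fst)).coe_nnreal_ennreal
  · exact (M.measurable_outcome_apply x).comp measurable_snd

lemma measurable_pay (i : Fin n) : Measurable (M.pay i) := by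
  unfold pay
  simp only [lintegral_fintype]
  refine Finset.measurable_sum _ fun x _ => Measurable.mul ?_ (M.measurable_outcome_apply x)
  exact (M.measurable_payment x i).coe_nnreal_ennreal

lemma expValue_ne_top (i : Fin n) (w : C) (μ : Measure (Fin n → C)) [IsProbabilityMeasure μ] :
    M.expValue i w μ ≠ ⊤ := by
  have := M.isMarkov
  have h : M.expValue i w μ ≤ ∑ S, ((w : Valuation m) S : ℝ≥0∞) := by
    have h1 : ∀ b, ∫⁻ x, ((w : Valuation m) (x.bundle i) : ℝ≥0∞) ∂(M.outcome b)
        ≤ ∑ S, ((w : Valuation m) S : ℝ≥0∞) := by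
      intro b
      refine (lintegral_mono fun x : Allocation n m => Finset.single_le_sum
        (f := fun S => ((w : Valuation m) S : ℝ≥0∞)) (fun _ _ => zero_le)
        (Finset.mem_univ (x.bundle i))).trans ?_
      simp
    refine (lintegral_mono h1).trans ?_
    simp
  exact ne_top_of_le_ne_top (ENNReal.sum_ne_top.2 fun S _ => ENNReal.coe_ne_top) h

lemma expValue_pi_update (i : Fin n) (w : C) (μ : Fin n → Measure C)
    [∀ j, IsProbabilityMeasure (μ j)] (ν : Measure C) [IsProbabilityMeasure ν] :
    M.expValue i w (Measure.pi (Function.update μ i ν))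
      = ∫⁻ y, ∫⁻ b, M.value i w (Function.update b i y) ∂Measure.pi μ ∂ν :=
  lintegral_pi_update μ i ν ((M.measurable_value i).comp (measurable_const.prodMk measurable_id))

lemma expPayment_pi_update (i : Fin n) (μ : Fin n → Measure C)
    [∀ j, IsProbabilityMeasure (μ j)] (ν : Measure C) [IsProbabilityMeasure ν] :
    M.expPayment i (Measure.pi (Function.update μ i ν))
      = ∫⁻ y, ∫⁻ b, M.pay i (Function.update b i y) ∂Measure.pi μ ∂ν :=
  lintegral_pi_update μ i ν (M.measurable_pay i)

/-- The expected welfare as a sum of the expected values of the bidders, bidder `i` evaluating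
the outcome by his valuation and the others being averaged out. -/
lemma bayesWelfare_eq (D : Fin n → ProbabilityMeasure C) (s : Fin n → Kernel C C)
    [∀ i, IsMarkovKernel (s i)] :
    M.bayesWelfare D s = ∑ i, ∫⁻ w, M.expValue i w (Measure.pi (Function.update
      (fun j => (D j : Measure C).bind (s j)) i (s i w))) ∂(D i : Measure C) := by
  have hsnd : Measurable fun q : Fin n → C × C => fun i => (q i).2 :=
    measurable_pi_lambda _ fun i => measurable_snd.comp (measurable_pi_apply i)
  have hval : ∀ i, Measurable fun q : Fin n → C × C => M.value i (q i).1 fun l => (q l).2 :=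
    fun i => (M.measurable_value i).comp
      ((measurable_fst.comp (measurable_pi_apply i)).prodMk hsnd)
  have h1 : M.bayesWelfare D s = ∑ i, ∫⁻ q : Fin n → C × C, M.value i (q i).1 (fun l => (q l).2)
      ∂(Measure.pi fun i => (D i : Measure C) ⊗ₘ s i) := by
    rw [← lintegral_finsetSum _ fun i _ => hval i]
    refine lintegral_congr fun q => ?_
    exact lintegral_finsetSum _ fun i _ => measurable_of_finite _
  rw [h1]
  refine Finset.sum_congr rfl fun i _ => ?_
  have hupd : (fun i => (D i : Measure C) ⊗ₘ s i)
      = Function.update (fun i => (D i : Measure C) ⊗ₘ s i) i ((D i : Measure C) ⊗ₘ s i) := by simp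
  have hmap : (Measure.pi fun i => (D i : Measure C) ⊗ₘ s i).map (fun q i => (q i).2)
      = Measure.pi fun j => (D j : Measure C).bind (s j) := by
    rw [Measure.pi_map_pi (f := fun _ => Prod.snd) fun i => measurable_snd.aemeasurable]
    congr 1
    funext j
    exact Measure.snd_compProd _ _
  have hmeas : Measurable fun p : (C × C) × (Fin n → C) =>
      M.value i p.1.1 (Function.update p.2 i p.1.2) :=
    (M.measurable_value i).comp ((measurable_fst.comp measurable_fst).prodMk
      (measurable_update'.comp (measurable_snd.prodMk (measurable_snd.comp measurable_fst))))
  rw [hupd, lintegral_pi_update _ _ _ (hval i)]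
  have hinner : ∀ z : C × C, ∫⁻ q : Fin n → C × C, M.value i (Function.update q i z i).1
        (fun l => (Function.update q i z l).2) ∂(Measure.pi fun i => (D i : Measure C) ⊗ₘ s i)
      = ∫⁻ b, M.value i z.1 (Function.update b i z.2)
          ∂(Measure.pi fun j => (D j : Measure C).bind (s j)) := by
    intro z
    have hb : Measurable fun b => M.value i z.1 (Function.update b i z.2) :=
      hmeas.comp (measurable_const.prodMk measurable_id)
    rw [← hmap, lintegral_map hb hsnd]
    refine lintegral_congr fun q => ?_
    rw [Function.update_self]
    congr 1
    funext l
    rcases eq_or_ne l i with rfl | h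
    · simp
    · simp [h]
  simp only [hinner]
  rw [Measure.lintegral_compProd hmeas.lintegral_prod_right']
  refine lintegral_congr fun w => ?_
  rw [expValue_pi_update]

/-- A mixed Nash equilibrium is a mixed Bayes-Nash equilibrium for point masses on the
valuations. -/
lemma PoA_le_BPoA : M.PoA ≤ M.BPoA := by
  refine iSup_le fun v => iSup_le fun σ => iSup_le fun hσ => ?_
  let D : Fin n → ProbabilityMeasure C := fun i => ⟨Measure.dirac (v i), inferInstance⟩
  let s : Fin n → Kernel C C := fun i => Kernel.const C (σ i : Measure C)
  have hs : ∀ i, IsMarkovKernel (s i) := fun i => inferInstance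
  have hbind : (fun j => (D j : Measure C).bind (s j)) = fun j => (σ j : Measure C) := by
    funext j
    simp [D, s]
  have hupd : ∀ i, Function.update (fun j => (σ j : Measure C)) i (σ i : Measure C)
      = fun j => (σ j : Measure C) := fun i => by simp
  have heq : M.IsMixedBayesNash D s := by
    intro i
    have : ∀ᵐ w ∂(Measure.dirac (v i)), w = v i := by simp [ae_dirac_eq]
    change ∀ᵐ w ∂(Measure.dirac (v i)), _
    filter_upwards [this] with w hw τ
    subst hw
    rw [hbind]
    simpa [s, hupd] using hσ i τ
  have hpi : Measure.pi (fun i => (D i : Measure C)) = Measure.dirac v := by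
    refine Measure.pi_eq fun S hS => ?_
    rw [Measure.dirac_apply' _ (MeasurableSet.univ_pi hS)]
    simp only [D, ProbabilityMeasure.coe_mk, Measure.dirac_apply' _ (hS _)]
    by_cases h : v ∈ Set.univ.pi S
    · rw [Set.indicator_of_mem h]
      exact (Finset.prod_eq_one fun i _ => Set.indicator_of_mem (h i (Set.mem_univ i)) _).symm
    · rw [Set.indicator_of_notMem h]
      obtain ⟨i, hi⟩ : ∃ i, v i ∉ S i := by simpa [Set.mem_pi] using h
      exact (Finset.prod_eq_zero (Finset.mem_univ i) (Set.indicator_of_notMem hi _)).symm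
  refine le_trans (le_of_eq ?_) (le_iSup_of_le D (le_iSup_of_le s
    (le_iSup_of_le hs (le_iSup_of_le heq le_rfl))))
  rw [hpi, lintegral_dirac, bayesWelfare_eq, hbind]
  congr 1
  refine Finset.sum_congr rfl fun i _ => ?_
  change _ = ∫⁻ w, _ ∂(Measure.dirac (v i))
  rw [lintegral_dirac]
  simp [s]

end Mechanism

/-! ### Equilibria of the rounded mechanism -/

lemma add_half_le_of_sub_half_le_sub {a c d : ℝ≥0∞} (ha : a ≠ ⊤) (hc : c ≠ ⊤)
    (h : (a : EReal) - ((a / 2 : ℝ≥0∞) : EReal) ≤ (c : EReal) - (d : EReal)) : d + a / 2 ≤ c := by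
  lift a to ℝ≥0 using ha
  lift c to ℝ≥0 using hc
  have h2 : ((a : ℝ≥0∞) / 2) = ((a / 2 : ℝ≥0) : ℝ≥0∞) := by
    rw [ENNReal.coe_div two_ne_zero]; rfl
  rw [h2] at h ⊢
  have hreal : ∀ x : ℝ≥0, ((x : ℝ≥0∞) : EReal) = ((x : ℝ) : EReal) := fun _ => rfl
  induction d with
  | top =>
    rw [hreal, hreal, ← EReal.coe_sub, EReal.coe_ennreal_top, EReal.sub_top, le_bot_iff] at h
    exact absurd h (EReal.coe_ne_bot _)
  | coe d =>
    rw [hreal, hreal, hreal, hreal, ← EReal.coe_sub, ← EReal.coe_sub, EReal.coe_le_coe_iff] at h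
    push_cast at h
    norm_cast
    rw [← NNReal.coe_le_coe]
    push_cast
    linarith

lemma measurable_halve : Measurable (halve : Valuation m → Valuation m) :=
  measurable_pi_lambda _ fun S => (measurable_pi_apply S).div_const 2

/-- A bidder with valuation `w` who cannot gain by bidding `w / 2`: such a bid costs half of the
value that it brings, so his payment and half of that value are together at most his value. The
payment is then finite, so no subtraction of infinities is involved. -/
lemma expPayment_add_half_le (f : Kernel (Fin n → C) (Allocation n m)) (hf : IsMarkovKernel f)
    (μ : Fin n → Measure C) [∀ j, IsProbabilityMeasure (μ j)] (i : Fin n) (w : C)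
    (hw : halve (w : Valuation m) ∈ C) (ν : Measure C) [IsProbabilityMeasure ν]
    (h : (payYourBid f hf).expUtility i w
        (Measure.pi (Function.update μ i (Measure.dirac ⟨halve w, hw⟩)))
      ≤ (payYourBid f hf).expUtility i w (Measure.pi (Function.update μ i ν))) :
    (payYourBid f hf).expPayment i (Measure.pi (Function.update μ i ν))
      + (∫⁻ b, (payYourBid f hf).value i w (Function.update b i ⟨halve w, hw⟩) ∂Measure.pi μ) / 2
      ≤ (payYourBid f hf).expValue i w (Measure.pi (Function.update μ i ν)) := by
  set M := payYourBid f hf with hM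
  have hprob : ∀ (ν : Measure C) [IsProbabilityMeasure ν],
      IsProbabilityMeasure (Measure.pi (Function.update μ i ν)) := by
    intro ν _
    have : ∀ j, IsProbabilityMeasure (Function.update μ i ν j) := by
      intro j
      rcases eq_or_ne j i with rfl | hj
      · rw [Function.update_self]; infer_instance
      · rw [Function.update_of_ne hj]; infer_instance
    infer_instance
  have hv : M.expValue i w (Measure.pi (Function.update μ i (Measure.dirac ⟨halve w, hw⟩)))
      = ∫⁻ b, M.value i w (Function.update b i ⟨halve w, hw⟩) ∂Measure.pi μ := by
    rw [M.expValue_pi_update, lintegral_dirac]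
  have hp : M.expPayment i (Measure.pi (Function.update μ i (Measure.dirac ⟨halve w, hw⟩)))
      = (∫⁻ b, M.value i w (Function.update b i ⟨halve w, hw⟩) ∂Measure.pi μ) / 2 := by
    rw [M.expPayment_pi_update, lintegral_dirac, div_eq_mul_inv,
      ← lintegral_mul_const' _ _ (by simp)]
    refine lintegral_congr fun b => ?_
    rw [Mechanism.pay, Mechanism.value, ← lintegral_mul_const' _ _ (by simp)]
    refine lintegral_congr fun x => ?_
    simp only [hM, payYourBid, Function.update_self, halve]
    rw [ENNReal.coe_div two_ne_zero, div_eq_mul_inv]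
    rfl
  have := hprob (Measure.dirac ⟨halve w, hw⟩)
  have := hprob ν
  unfold Mechanism.expUtility at h
  rw [hp, ← hv] at h
  rw [← hv]
  exact add_half_le_of_sub_half_le_sub (M.expValue_ne_top _ _ _) (M.expValue_ne_top _ _ _) h

/-- Smoothness carries over to the rounded mechanism at the loss of a factor `α`: rounding keeps a
`1/α` fraction of each deviator's fractional value and of each fractional payment. -/
lemma optWelfare_le_of_rounding {f' : (Fin n → C) → ConfigLP n m} (hf' : IsExactSolver f')
    {r : Kernel (ConfigLP n m) (Allocation n m)} [IsMarkovKernel r] {α : ℝ}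
    (hr : IsObliviousRounding C α r) (hC : C ⊆ MPH m k) (hh : ∀ v ∈ C, halve v ∈ C)
    (v b : Fin n → C) :
    optWelfare v ≤ 2 * ENNReal.ofReal α *
      ∑ i, ((payYourBid (r.comap f' hf'.measurable) inferInstance).value i (v i)
          (Function.update b i ⟨halve (v i), hh _ (v i).2⟩) / 2
        + (k + 1) * (payYourBid (r.comap f' hf'.measurable) inferInstance).pay i b) := by
  refine iSup_le fun a => ?_
  have h := hf'.smooth hC hh v b a
  have hround : ∀ (b : Fin n → C) (i : Fin n) (w : C), (fracValue (w : Valuation m) i (f' b) : ℝ≥0∞)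
      ≤ ENNReal.ofReal α *
        (payYourBid (r.comap f' hf'.measurable) inferInstance).value i w b := by
    intro b i w
    have := hr.2 (f' b) i w w.2
    simpa [Mechanism.value, payYourBid, Kernel.comap_apply] using this
  have hpay : ∀ i, (payYourBid (r.comap f' hf'.measurable) inferInstance).pay i b
      = (payYourBid (r.comap f' hf'.measurable) inferInstance).value i (b i) b := fun i => rfl
  rw [← ENNReal.coe_le_coe] at h
  have htwo : ∀ x : ℝ≥0, ((x / 2 : ℝ≥0) : ℝ≥0∞) = x / 2 := fun x => by
    rw [ENNReal.coe_div two_ne_zero]; rfl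
  simp only [ENNReal.coe_add, ENNReal.ofNNReal_finsetSum, htwo, ENNReal.coe_mul, ENNReal.coe_natCast,
    ENNReal.coe_one] at h
  have hmain : ∑ i, ((v i : Valuation m) (a.bundle i) : ℝ≥0∞) / 2 ≤ ENNReal.ofReal α *
      ∑ i, ((payYourBid (r.comap f' hf'.measurable) inferInstance).value i (v i)
          (Function.update b i ⟨halve (v i), hh _ (v i).2⟩) / 2
        + (k + 1) * (payYourBid (r.comap f' hf'.measurable) inferInstance).pay i b) := by
    refine h.trans ?_
    rw [Finset.mul_sum, Finset.mul_sum, ← Finset.sum_add_distrib]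
    refine Finset.sum_le_sum fun i _ => ?_
    rw [mul_add, hpay]
    refine add_le_add ?_ ?_
    · rw [← mul_div_assoc]
      gcongr
      exact hround _ i _
    · rw [mul_left_comm]
      gcongr
      exact hround _ i _
  calc ∑ i, ((v i : Valuation m) (a.bundle i) : ℝ≥0∞)
      = 2 * ∑ i, ((v i : Valuation m) (a.bundle i) : ℝ≥0∞) / 2 := by
        rw [Finset.mul_sum]
        exact Finset.sum_congr rfl fun i _ =>
          (ENNReal.mul_div_cancel two_ne_zero ENNReal.ofNat_ne_top).symm
    _ ≤ 2 * (ENNReal.ofReal α * _) := mul_le_mul' le_rfl hmain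
    _ = _ := (mul_assoc _ _ _).symm

/-- The efficiency bound: average `optWelfare_le_of_rounding` over valuations and bids drawn
independently of each other, and absorb the deviation values and the payments by the equilibrium
condition. -/
theorem BPoA_le_of_rounding {f' : (Fin n → C) → ConfigLP n m} (hf' : IsExactSolver f')
    {r : Kernel (ConfigLP n m) (Allocation n m)} [IsMarkovKernel r] {α : ℝ}
    (hr : IsObliviousRounding C α r) (hC : C ⊆ MPH m k) (hh : ∀ v ∈ C, halve v ∈ C) :
    (payYourBid (r.comap f' hf'.measurable) inferInstance).BPoA
      ≤ ENNReal.ofReal (2 * (k + 1) * α) := by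
  have hsm := fun v b => optWelfare_le_of_rounding hf' hr hC hh v b
  set M := payYourBid (r.comap f' hf'.measurable) inferInstance with hM
  refine iSup_le fun D => iSup_le fun s => iSup_le fun hs => iSup_le fun heq => ?_
  refine ENNReal.div_le_of_le_mul ?_
  set μ : Fin n → Measure C := fun j => (D j : Measure C).bind (s j) with hμ
  let h : C → C := fun w => ⟨halve w, hh _ w.2⟩
  have hmh : Measurable h := (measurable_halve.comp measurable_subtype_coe).subtype_mk
  have hmg : ∀ i, Measurable fun p : C × (Fin n → C) =>
      M.value i p.1 (Function.update p.2 i (h p.1)) := fun i =>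
    (M.measurable_value i).comp (measurable_fst.prodMk
      (measurable_update'.comp (measurable_snd.prodMk (hmh.comp measurable_fst))))
  have hmE : ∀ i, Measurable fun w =>
      ∫⁻ b, M.value i w (Function.update b i (h w)) ∂Measure.pi μ :=
    fun i => (hmg i).lintegral_prod_right'
  -- the equilibrium condition, averaged over the valuation of bidder `i`
  have hi : ∀ i, ∫⁻ b, M.pay i b ∂Measure.pi μ
      + (∫⁻ w, ∫⁻ b, M.value i w (Function.update b i (h w)) ∂Measure.pi μ ∂(D i : Measure C)) / 2
      ≤ ∫⁻ w, M.expValue i w (Measure.pi (Function.update μ i (s i w))) ∂(D i : Measure C) := by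
    intro i
    have h1 : ∀ᵐ w ∂(D i : Measure C), M.expPayment i (Measure.pi (Function.update μ i (s i w)))
        + (∫⁻ b, M.value i w (Function.update b i (h w)) ∂Measure.pi μ) / 2
        ≤ M.expValue i w (Measure.pi (Function.update μ i (s i w))) := by
      filter_upwards [heq i] with w hw
      exact expPayment_add_half_le _ _ μ i w (hh _ w.2) (s i w)
        (hw ⟨Measure.dirac (h w), inferInstance⟩)
    have h2 := lintegral_mono_ae h1
    have h3 : ∫⁻ w, M.expPayment i (Measure.pi (Function.update μ i (s i w))) ∂(D i : Measure C)
        = ∫⁻ b, M.pay i b ∂Measure.pi μ := by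
      have hmp : Measurable fun y => ∫⁻ b, M.pay i (Function.update b i y) ∂Measure.pi μ :=
        ((M.measurable_pay i).comp
          (measurable_update'.comp measurable_swap) :
            Measurable fun p : C × (Fin n → C) => M.pay i (Function.update p.2 i p.1)
          ).lintegral_prod_right'
      have hself : Measure.pi μ = Measure.pi (Function.update μ i (μ i)) := by simp
      simp only [M.expPayment_pi_update]
      conv_rhs => rw [hself, lintegral_pi_update μ i (μ i) (M.measurable_pay i)]
      rw [hμ, Measure.lintegral_bind (s i).measurable.aemeasurable hmp.aemeasurable]
    rw [lintegral_add_right _ ((hmE i).div_const 2), h3] at h2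
    simpa only [div_eq_mul_inv, lintegral_mul_const _ (hmE i)] using h2
  have hE : ∀ i, ∫⁻ v, ∫⁻ b, M.value i (v i) (Function.update b i (h (v i))) ∂Measure.pi μ
        ∂(Measure.pi fun i => (D i : Measure C))
      = ∫⁻ w, ∫⁻ b, M.value i w (Function.update b i (h w)) ∂Measure.pi μ ∂(D i : Measure C) := by
    intro i
    rw [← (measurePreserving_eval (fun i => (D i : Measure C)) i).map_eq,
      lintegral_map (hmE i) (measurable_pi_apply i)]
  have hk : (k + 1 : ℝ≥0∞) * 2 * ENNReal.ofReal α = ENNReal.ofReal (2 * (k + 1) * α) := by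
    rw [ENNReal.ofReal_mul (by positivity), ENNReal.ofReal_mul (by positivity),
      ENNReal.ofReal_add (by positivity) zero_le_one]
    simp [mul_comm]
  calc ∫⁻ v, optWelfare v ∂(Measure.pi fun i => (D i : Measure C))
      ≤ ∫⁻ v, ∫⁻ b, 2 * ENNReal.ofReal α *
          ∑ i, (M.value i (v i) (Function.update b i (h (v i))) / 2 + (k + 1) * M.pay i b)
          ∂Measure.pi μ ∂(Measure.pi fun i => (D i : Measure C)) := by
        refine lintegral_mono fun v => ?_
        calc optWelfare v = ∫⁻ _, optWelfare v ∂Measure.pi μ := by simp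
          _ ≤ _ := lintegral_mono fun b => hsm v b
    _ = 2 * ENNReal.ofReal α * ∑ i,
          ((∫⁻ w, ∫⁻ b, M.value i w (Function.update b i (h w)) ∂Measure.pi μ
              ∂(D i : Measure C)) / 2
            + (k + 1) * ∫⁻ b, M.pay i b ∂Measure.pi μ) := by
        have hvm : ∀ (v : Fin n → C) i,
            Measurable fun b => M.value i (v i) (Function.update b i (h (v i))) / 2 :=
          fun v i => ((hmg i).comp (measurable_const.prodMk measurable_id)).div_const 2
        have inner : ∀ v : Fin n → C, ∫⁻ b, 2 * ENNReal.ofReal α *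
              ∑ i, (M.value i (v i) (Function.update b i (h (v i))) / 2 + (k + 1) * M.pay i b)
              ∂Measure.pi μ
            = 2 * ENNReal.ofReal α * ∑ i,
              ((∫⁻ b, M.value i (v i) (Function.update b i (h (v i))) ∂Measure.pi μ) / 2
                + (k + 1) * ∫⁻ b, M.pay i b ∂Measure.pi μ) := by
          intro v
          rw [lintegral_const_mul' _ _ (by finiteness), lintegral_finsetSum _ fun i _ =>
            (hvm v i).fun_add ((M.measurable_pay i).const_mul _)]
          congr 1
          refine Finset.sum_congr rfl fun i _ => ?_
          rw [lintegral_add_left (hvm v i), lintegral_const_mul _ (M.measurable_pay i)]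
          simp only [div_eq_mul_inv]
          rw [lintegral_mul_const' _ _ (by simp)]
        have hom : ∀ i, Measurable fun v : Fin n → C =>
            (∫⁻ b, M.value i (v i) (Function.update b i (h (v i))) ∂Measure.pi μ) / 2 :=
          fun i => ((hmE i).comp (measurable_pi_apply i)).div_const 2
        simp only [inner]
        rw [lintegral_const_mul' _ _ (by finiteness),
          lintegral_finsetSum _ fun i _ => (hom i).fun_add measurable_const]
        congr 1
        refine Finset.sum_congr rfl fun i _ => ?_
        rw [lintegral_add_left (hom i), lintegral_const, measure_univ, mul_one, ← hE i]
        simp only [div_eq_mul_inv]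
        rw [lintegral_mul_const' _ _ (by simp)]
    _ ≤ 2 * ENNReal.ofReal α * ∑ i, (k + 1) *
          ∫⁻ w, M.expValue i w (Measure.pi (Function.update μ i (s i w))) ∂(D i : Measure C) := by
        gcongr with i
        refine le_trans ?_ (mul_le_mul_right (hi i) (k + 1 : ℝ≥0∞))
        rw [mul_add, add_comm]
        gcongr
        exact le_mul_of_one_le_left zero_le le_add_self
    _ = ENNReal.ofReal (2 * (k + 1) * α) * M.bayesWelfare D s := by
        rw [M.bayesWelfare_eq, ← Finset.mul_sum, ← hk]
        ring

/-! ### Random allocations with finitely many outcomes -/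

/-- The random allocation `out ω` where `ω` is drawn from a finite set with probability `W x ω`. -/
noncomputable def kernelOfWeights {Ω : Type*} [Fintype Ω] (W : ConfigLP n m → Ω → ℝ)
    (hW : ∀ ω, Measurable fun x => W x ω) (out : Ω → Allocation n m) :
    Kernel (ConfigLP n m) (Allocation n m) where
  toFun x := ∑ ω, ENNReal.ofReal (W x ω) • Measure.dirac (out ω)
  measurable' := by
    refine Measure.measurable_of_measurable_coe _ fun s _ => ?_
    simp only [Measure.coe_finsetSum, Finset.sum_apply, Measure.smul_apply, smul_eq_mul]
    exact Finset.measurable_sum _ fun ω _ => (hW ω).ennreal_ofReal.mul_const _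

lemma isMarkovKernel_kernelOfWeights {Ω : Type*} [Fintype Ω] (W : ConfigLP n m → Ω → ℝ)
    (hW : ∀ ω, Measurable fun x => W x ω) (out : Ω → Allocation n m) (h0 : ∀ x ω, 0 ≤ W x ω)
    (h1 : ∀ x, ∑ ω, W x ω = 1) : IsMarkovKernel (kernelOfWeights W hW out) := by
  refine ⟨fun x => ⟨?_⟩⟩
  change (∑ ω, ENNReal.ofReal (W x ω) • Measure.dirac (out ω)) Set.univ = 1
  simp only [Measure.coe_finsetSum, Finset.sum_apply, Measure.smul_apply, smul_eq_mul,
    measure_univ, mul_one]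
  rw [← ENNReal.ofReal_sum_of_nonneg fun ω _ => h0 x ω, h1, ENNReal.ofReal_one]

lemma isObliviousRounding_kernelOfWeights {Ω : Type*} [Fintype Ω] (W : ConfigLP n m → Ω → ℝ)
    (hW : ∀ ω, Measurable fun x => W x ω) (out : Ω → Allocation n m) (h0 : ∀ x ω, 0 ≤ W x ω)
    {α : ℝ} (hα : 1 ≤ α) (h : ∀ (x : ConfigLP n m) (i : Fin n), ∀ w ∈ C,
      (fracValue w i x : ℝ) ≤ α * ∑ ω, W x ω * w ((out ω).bundle i)) :
    IsObliviousRounding C α (kernelOfWeights W hW out) := by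
  refine ⟨hα, fun x i w hw => ?_⟩
  have hint : ∫⁻ a, (w (a.bundle i) : ℝ≥0∞) ∂(kernelOfWeights W hW out x)
      = ENNReal.ofReal (∑ ω, W x ω * w ((out ω).bundle i)) := by
    change ∫⁻ a, (w (a.bundle i) : ℝ≥0∞) ∂(∑ ω, ENNReal.ofReal (W x ω) • Measure.dirac (out ω)) = _
    rw [lintegral_finsetSum_measure, ENNReal.ofReal_sum_of_nonneg
      fun ω _ => mul_nonneg (h0 x ω) (NNReal.coe_nonneg _)]
    refine Finset.sum_congr rfl fun ω _ => ?_
    rw [lintegral_smul_measure, lintegral_dirac, ENNReal.ofReal_mul (h0 x ω),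
      ENNReal.ofReal_coe_nnreal, smul_eq_mul]
  rw [hint, ← ENNReal.ofReal_mul (zero_le_one.trans hα), ← ENNReal.ofReal_coe_nnreal]
  exact ENNReal.ofReal_le_ofReal (h x i w hw)

/-- Under a product of weights, the coordinate `i` is independent of the others. -/
lemma sum_prod_mul_prod_erase {ι β : Type*} [Fintype ι] [DecidableEq ι] [Fintype β]
    (y φ : ι → β → ℝ) (g : β → ℝ) (i : ι) :
    ∑ S : ι → β, (∏ l, y l (S l)) * (g (S i) * ∏ l ∈ Finset.univ.erase i, φ l (S l))
      = (∑ U, y i U * g U) * ∏ l ∈ Finset.univ.erase i, ∑ U, y l U * φ l U := by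
  have h := Fintype.prod_sum fun l U => y l U * Function.update φ i g l U
  rw [← Finset.mul_prod_erase _ _ (Finset.mem_univ i), Function.update_self] at h
  rw [Finset.prod_congr rfl fun l hl => Finset.sum_congr rfl fun U _ => by
    rw [Function.update_of_ne (Finset.ne_of_mem_erase hl)]] at h
  rw [h]
  refine Finset.sum_congr rfl fun S _ => ?_
  rw [Finset.prod_mul_distrib, ← Finset.mul_prod_erase _ (fun l => Function.update φ i g l (S l))
    (Finset.mem_univ i), Function.update_self]
  congr 2
  exact Finset.prod_congr rfl fun l hl => by rw [Function.update_of_ne (Finset.ne_of_mem_erase hl)]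

/-- The probability that bidder `i` asks for the bundle `S`, when he asks for it with probability
`c * x i S` and for nothing otherwise. -/
noncomputable def request (c : ℝ) (x : ConfigLP n m) (i : Fin n) (S : Finset (Fin m)) : ℝ :=
  c * x.1 i S + if S = ∅ then 1 - c * ∑ U, (x.1 i U : ℝ) else 0

/-- The total fraction of item `j` assigned to bidder `i` by `x`. -/
noncomputable def share (x : ConfigLP n m) (j : Fin m) (i : Fin n) : ℝ :=
  ∑ S with j ∈ S, (x.1 i S : ℝ)

lemma share_nonneg (x : ConfigLP n m) (j : Fin m) (i : Fin n) : 0 ≤ share x j i :=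
  Finset.sum_nonneg fun _ _ => NNReal.coe_nonneg _

lemma sum_share_le_one (x : ConfigLP n m) (j : Fin m) : ∑ i, share x j i ≤ 1 := by
  have := x.2.2.1 j
  rw [← NNReal.coe_le_coe] at this
  push_cast at this
  exact this

lemma continuous_coord (i : Fin n) (S : Finset (Fin m)) :
    Continuous fun x : ConfigLP n m => (x.1 i S : ℝ) :=
  NNReal.continuous_coe.comp ((continuous_apply_apply i S).comp continuous_subtype_val)

lemma continuous_share (j : Fin m) : Continuous fun x : ConfigLP n m => share x j :=
  continuous_pi fun i => continuous_finsetSum _ fun S _ => continuous_coord i S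

lemma continuous_request (c : ℝ) (i : Fin n) (S : Finset (Fin m)) :
    Continuous fun x : ConfigLP n m => request c x i S := by
  have := fun U => continuous_coord (n := n) i (U : Finset (Fin m))
  unfold request
  split_ifs
  · exact (continuous_const.mul (this S)).add (continuous_const.sub
      (continuous_const.mul (continuous_finsetSum _ fun U _ => this U)))
  · exact (continuous_const.mul (this S)).add continuous_const

lemma sum_request (c : ℝ) (x : ConfigLP n m) (i : Fin n) : ∑ S, request c x i S = 1 := by
  simp only [request, Finset.sum_add_distrib, ← Finset.mul_sum, Finset.sum_ite_eq',
    Finset.mem_univ, if_true]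
  ring

lemma le_request {c : ℝ} (h1 : c ≤ 1) (x : ConfigLP n m) (i : Fin n)
    (S : Finset (Fin m)) : c * x.1 i S ≤ request c x i S := by
  have h := x.2.2.2 i
  rw [← NNReal.coe_le_coe] at h
  push_cast at h
  unfold request
  have : c * ∑ U, (x.1 i U : ℝ) ≤ 1 := mul_le_one₀ h1 (by positivity) h
  split_ifs
  · linarith
  · linarith

lemma request_nonneg {c : ℝ} (h0 : 0 ≤ c) (h1 : c ≤ 1) (x : ConfigLP n m) (i : Fin n)
    (S : Finset (Fin m)) : 0 ≤ request c x i S :=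
  le_trans (by positivity) (le_request h1 x i S)

lemma sum_request_mem (c : ℝ) (x : ConfigLP n m) (i : Fin n) (j : Fin m) :
    ∑ S with j ∈ S, request c x i S = c * share x j i := by
  rw [share, Finset.mul_sum]
  refine Finset.sum_congr rfl fun S hS => ?_
  have : S ≠ ∅ := by
    rintro rfl
    simp at hS
  simp [request, this]

lemma sum_prod_request (c : ℝ) (x : ConfigLP n m) :
    ∑ S : Fin n → Finset (Fin m), ∏ l, request c x l (S l) = 1 := by
  rw [← Fintype.prod_sum]
  exact Finset.prod_eq_one fun l _ => sum_request c x l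

/-! ### Rounding for MPH valuations -/

open Classical in
/-- Every item goes to the bidder who asks for it, provided that he is the only one. -/
noncomputable def uniqueRequester (S : Fin n → Finset (Fin m)) : Allocation n m :=
  ⟨fun j => if h : ∃ i, j ∈ S i ∧ ∀ l, l ≠ i → j ∉ S l then some h.choose else none⟩

lemma mem_bundle_uniqueRequester {S : Fin n → Finset (Fin m)} {i : Fin n} {j : Fin m}
    (hj : j ∈ S i) (h : ∀ l, l ≠ i → j ∉ S l) : j ∈ (uniqueRequester S).bundle i := by
  have hex : ∃ i, j ∈ S i ∧ ∀ l, l ≠ i → j ∉ S l := ⟨i, hj, h⟩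
  have : hex.choose = i := by
    by_contra hne
    exact h _ hne hex.choose_spec.1
  refine Finset.mem_filter.2 ⟨Finset.mem_univ j, ?_⟩
  change dite _ _ _ = _
  rw [dif_pos hex, this]

lemma one_sub_sum_le_prod {ι : Type*} (s : Finset ι) (f : ι → ℝ) (h0 : ∀ i ∈ s, 0 ≤ f i)
    (h1 : ∀ i ∈ s, f i ≤ 1) : 1 - ∑ i ∈ s, f i ≤ ∏ i ∈ s, (1 - f i) := by
  classical
  induction s using Finset.induction_on with
  | empty => simp
  | insert a s ha ih =>
    rw [Finset.sum_insert ha, Finset.prod_insert ha]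
    have h2 := ih (fun i hi => h0 i (Finset.mem_insert_of_mem hi))
      (fun i hi => h1 i (Finset.mem_insert_of_mem hi))
    have h3 : ∏ i ∈ s, (1 - f i) ≤ 1 :=
      Finset.prod_le_one (fun i hi => sub_nonneg.2 (h1 i (Finset.mem_insert_of_mem hi)))
        fun i hi => by linarith [h0 i (Finset.mem_insert_of_mem hi)]
    nlinarith [h0 a (Finset.mem_insert_self _ _)]

/-- If requests are scaled down by `1 / (2k)`, then with probability at least `1/2` a given set of
at most `k` items is not requested by anyone but bidder `i`. -/
lemma half_le_prod_disjoint (hk : 1 ≤ k) (x : ConfigLP n m) (i : Fin n) {T : Finset (Fin m)}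
    (hT : T.card ≤ k) :
    1 / 2 ≤ ∏ l ∈ Finset.univ.erase i,
      ∑ U, request (1 / (2 * k)) x l U * if Disjoint T U then 1 else 0 := by
  have hk' : (1 : ℝ) ≤ k := by exact_mod_cast hk
  have hc0 : (0 : ℝ) ≤ 1 / (2 * k) := by positivity
  have hc1 : (1 : ℝ) / (2 * k) ≤ 1 := by rw [div_le_one (by positivity)]; linarith
  set c : ℝ := 1 / (2 * k) with hc
  have hy := fun l U => request_nonneg hc0 hc1 x l U
  have hsplit : ∀ l, ∑ U, request c x l U * (if Disjoint T U then 1 else 0)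
      = 1 - ∑ U with ¬ Disjoint T U, request c x l U := by
    intro l
    have h := Finset.sum_filter_add_sum_filter_not Finset.univ (fun U => Disjoint T U)
      (request c x l)
    rw [sum_request] at h
    simp only [mul_ite, mul_one, mul_zero, ← Finset.sum_filter]
    linarith
  have hunion : ∀ l, ∑ U with ¬ Disjoint T U, request c x l U ≤ ∑ j ∈ T, c * share x j l := by
    intro l
    simp only [← sum_request_mem, Finset.sum_filter]
    rw [Finset.sum_comm]
    refine Finset.sum_le_sum fun U _ => ?_
    have hnn : ∀ j ∈ T, 0 ≤ if j ∈ U then request c x l U else 0 := by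
      intro j _
      split_ifs
      exacts [hy l U, le_rfl]
    by_cases h : Disjoint T U
    · rw [if_neg (not_not.2 h)]
      exact Finset.sum_nonneg hnn
    · obtain ⟨j, hj, hjU⟩ := Finset.not_disjoint_iff.1 h
      rw [if_pos h]
      exact le_trans (by rw [if_pos hjU]) (Finset.single_le_sum hnn hj)
  simp only [hsplit]
  refine le_trans ?_ (one_sub_sum_le_prod _ _ (fun l _ => Finset.sum_nonneg fun U _ => hy l U)
    fun l _ => ?_)
  · have : ∑ l ∈ Finset.univ.erase i, ∑ U with ¬ Disjoint T U, request c x l U ≤ 1 / 2 := by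
      calc ∑ l ∈ Finset.univ.erase i, ∑ U with ¬ Disjoint T U, request c x l U
          ≤ ∑ l, ∑ j ∈ T, c * share x j l := by
            refine (Finset.sum_le_sum fun l _ => hunion l).trans
              (Finset.sum_le_sum_of_subset_of_nonneg (Finset.erase_subset _ _) fun l _ _ => ?_)
            exact Finset.sum_nonneg fun j _ => mul_nonneg hc0 (share_nonneg x j l)
        _ = ∑ j ∈ T, c * ∑ l, share x j l := by
            rw [Finset.sum_comm]
            simp only [Finset.mul_sum]
        _ ≤ ∑ j ∈ T, c * 1 := by
            gcongr with j
            exact sum_share_le_one x j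
        _ = T.card * c := by simp
        _ ≤ k * c := by gcongr
        _ = 1 / 2 := by rw [hc]; field_simp
    linarith
  · rw [← sum_request c x l]
    exact Finset.sum_le_sum_of_subset_of_nonneg (Finset.filter_subset _ _) fun U _ _ => hy l U

/-- Sample a request from each bidder, scaled down by `1 / (2k)`, and give every item to its only
requester. A set of at most `k` items in the request of a bidder survives with probability at least
`1/2`, so he keeps a fraction `1 / (4k)` of his value. -/
theorem exists_rounding_MPH (n m : ℕ) (hk : 1 ≤ k) :
    ∃ (r : Kernel (ConfigLP n m) (Allocation n m)) (_ : IsMarkovKernel r),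
      IsObliviousRounding (MPH m k) (4 * k) r := by
  have hk' : (1 : ℝ) ≤ k := by exact_mod_cast hk
  have hc0 : (0 : ℝ) ≤ 1 / (2 * k) := by positivity
  have hc1 : (1 : ℝ) / (2 * k) ≤ 1 := by rw [div_le_one (by positivity)]; linarith
  let W : ConfigLP n m → (Fin n → Finset (Fin m)) → ℝ :=
    fun x S => ∏ l, request (1 / (2 * k)) x l (S l)
  have hW : ∀ S, Measurable fun x => W x S := fun S =>
    (continuous_finsetProd _ fun l _ => continuous_request _ l (S l)).measurable
  have h0 : ∀ x S, 0 ≤ W x S := fun x S =>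
    Finset.prod_nonneg fun l _ => request_nonneg hc0 hc1 x l (S l)
  refine ⟨kernelOfWeights W hW uniqueRequester,
    isMarkovKernel_kernelOfWeights W hW _ h0 fun x => sum_prod_request _ x,
    isObliviousRounding_kernelOfWeights W hW _ h0 (by linarith) fun x i w hw => ?_⟩
  choose a haU ha using fun U => MPH.exists_support hw U
  let g : Finset (Fin m) → Finset (Fin m) → ℝ :=
    fun T U => if T ⊆ U ∧ T.card ≤ k then (a U T : ℝ) else 0
  have hg0 : ∀ T U, 0 ≤ g T U := by
    intro T U
    dsimp only [g]
    split_ifs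
    exacts [NNReal.coe_nonneg _, le_rfl]
  have hgsum : ∀ U, (w U : ℝ) = ∑ T, g T U := by
    intro U
    rw [haU, NNReal.coe_sum, ← Finset.sum_filter]
    refine Finset.sum_congr ?_ fun _ _ => rfl
    ext T
    simp
  have hbundle : ∀ S : Fin n → Finset (Fin m),
      ∑ T, g T (S i) * ∏ l ∈ Finset.univ.erase i, (if Disjoint T (S l) then (1 : ℝ) else 0)
        ≤ w ((uniqueRequester S).bundle i) := by
    intro S
    refine le_trans ?_ (NNReal.coe_le_coe.2 (ha (S i) ((uniqueRequester S).bundle i)))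
    rw [NNReal.coe_sum, Finset.sum_filter, ← Finset.sum_subset (Finset.subset_univ
      ((uniqueRequester S).bundle i).powerset)]
    · refine Finset.sum_le_sum fun T hT => ?_
      refine (mul_le_of_le_one_right (hg0 _ _) (Finset.prod_le_one (fun l _ => ?_)
        fun l _ => ?_)).trans ?_
      · split_ifs <;> norm_num
      · split_ifs <;> norm_num
      · dsimp only [g]
        split_ifs with h1 h2 h2
        · exact le_rfl
        · exact absurd h1.2 h2
        · exact NNReal.coe_nonneg _
        · exact le_rfl
    · intro T _ hT
      by_contra hne
      obtain ⟨hne1, hne2⟩ := mul_ne_zero_iff.1 hne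
      refine hT (Finset.mem_powerset.2 fun j hj => ?_)
      have h1 : T ⊆ S i := by
        by_contra h
        exact hne1 (if_neg fun h' => h h'.1)
      refine mem_bundle_uniqueRequester (h1 hj) fun l hl hjl => ?_
      refine Finset.prod_ne_zero_iff.1 hne2 l (Finset.mem_erase.2 ⟨hl, Finset.mem_univ l⟩) ?_
      exact if_neg (Finset.not_disjoint_iff.2 ⟨j, hj, hjl⟩)
  have hmain : 1 / (4 * k) * (fracValue w i x : ℝ)
      ≤ ∑ S, W x S * w ((uniqueRequester S).bundle i) := by
    calc 1 / (4 * k) * (fracValue w i x : ℝ)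
        = ∑ T, (∑ U, 1 / (2 * k) * x.1 i U * g T U) * (1 / 2) := by
          simp only [fracValue, NNReal.coe_sum, NNReal.coe_mul, hgsum, Finset.mul_sum,
            Finset.sum_mul]
          rw [Finset.sum_comm]
          refine Finset.sum_congr rfl fun T _ => Finset.sum_congr rfl fun U _ => ?_
          field_simp
          ring
      _ ≤ ∑ T, (∑ U, request (1 / (2 * k)) x i U * g T U) * ∏ l ∈ Finset.univ.erase i,
            ∑ U, request (1 / (2 * k)) x l U * (if Disjoint T U then 1 else 0) := by
          refine Finset.sum_le_sum fun T _ => ?_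
          have hle : ∑ U, 1 / (2 * k) * x.1 i U * g T U
              ≤ ∑ U, request (1 / (2 * k)) x i U * g T U := by
            exact Finset.sum_le_sum fun U _ =>
              mul_le_mul_of_nonneg_right (le_request hc1 x i U) (hg0 T U)
          by_cases hT : T.card ≤ k
          · exact mul_le_mul hle (half_le_prod_disjoint hk x i hT) (by norm_num)
              (Finset.sum_nonneg fun U _ => mul_nonneg (request_nonneg hc0 hc1 x i U) (hg0 T U))
          · have : ∀ U, g T U = 0 := fun U => if_neg fun h => hT h.2
            simp [this]
      _ = ∑ S, W x S * ∑ T, g T (S i) *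
            ∏ l ∈ Finset.univ.erase i, (if Disjoint T (S l) then (1 : ℝ) else 0) := by
          simp only [Finset.mul_sum]
          rw [Finset.sum_comm]
          refine Finset.sum_congr rfl fun T _ => ?_
          exact (sum_prod_mul_prod_erase _ (fun _ U => if Disjoint T U then (1 : ℝ) else 0)
            (g T) i).symm
      _ ≤ _ := by
          gcongr with S
          · exact h0 x S
          · exact hbundle S
  have := mul_le_mul_of_nonneg_left hmain (by positivity : (0 : ℝ) ≤ 4 * k)
  rwa [← mul_assoc, mul_one_div_cancel (by positivity), one_mul] at this

/-! ### Fair contention resolution for a single item -/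

/-- The probability that a bidder who requests the item with probability `p` has not yet rung at
time `t`, given that he does request it. His clock rings with density `e^{-sp}`, so
that, without conditioning, he has not rung with probability `e^{-tp}`. -/
noncomputable def silent (p t : ℝ) : ℝ := 1 - ∫ s in (0 : ℝ)..t, Real.exp (-(s * p))

lemma hasDerivAt_silent (p t : ℝ) : HasDerivAt (silent p) (-Real.exp (-(t * p))) t := by
  have hc : Continuous fun s : ℝ => Real.exp (-(s * p)) := by fun_prop
  exact (intervalIntegral.integral_hasDerivAt_right (hc.intervalIntegrable _ _)
    (hc.stronglyMeasurableAtFilter _ _) hc.continuousAt).const_sub 1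

lemma continuous_silent : Continuous fun q : ℝ × ℝ => silent q.1 q.2 := by
  refine continuous_const.sub ?_
  exact intervalIntegral.continuous_parametric_intervalIntegral_of_continuous
    (f := fun (q : ℝ × ℝ) s => Real.exp (-(s * q.1))) (by fun_prop) continuous_snd

lemma silent_zero (p : ℝ) : silent p 0 = 1 := by simp [silent]

lemma silent_nonneg {p t : ℝ} (hp : 0 ≤ p) (h0 : 0 ≤ t) (h1 : t ≤ 1) : 0 ≤ silent p t := by
  have hc : Continuous fun s : ℝ => Real.exp (-(s * p)) := by fun_prop
  have : ∫ s in (0 : ℝ)..t, Real.exp (-(s * p)) ≤ ∫ s in (0 : ℝ)..t, 1 := by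
    refine intervalIntegral.integral_mono_on h0 (hc.intervalIntegrable _ _) (by simp) fun s hs => ?_
    exact Real.exp_le_one_iff.2 (neg_nonpos.2 (mul_nonneg hs.1 hp))
  simp only [intervalIntegral.integral_const, sub_zero, smul_eq_mul, mul_one] at this
  rw [silent]
  linarith

lemma one_sub_add_mul_silent (p t : ℝ) : 1 - p + p * silent p t = Real.exp (-(t * p)) := by
  have hc : Continuous fun s : ℝ => p * Real.exp (-(s * p)) := by fun_prop
  have h := intervalIntegral.integral_eq_sub_of_hasDerivAt (a := 0) (b := t)
    (f := fun s => -Real.exp (-(s * p))) (f' := fun s => p * Real.exp (-(s * p)))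
    (fun s _ => by
      have := (((hasDerivAt_id s).mul_const p).neg.exp).neg
      convert! this using 1
      simp [mul_comm])
    (hc.intervalIntegrable _ _)
  rw [intervalIntegral.integral_const_mul] at h
  simp only [zero_mul, neg_zero, Real.exp_zero] at h
  rw [silent]
  linarith

/-- The probability that bidder `i` wins the item when exactly the bidders in `A` request it: the
item goes to the first bidder whose clock rings by time `1`. Here `p l` is the probability that
bidder `l` requests the item. -/
noncomputable def winProb (p : Fin n → ℝ) (A : Finset (Fin n)) (i : Fin n) : ℝ :=
  if i ∈ A then ∫ t in (0 : ℝ)..1, Real.exp (-(t * p i)) *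
    ∏ l ∈ Finset.univ.erase i, (if l ∈ A then silent (p l) t else 1) else 0

lemma continuous_winProb_integrand (A : Finset (Fin n)) (i : Fin n) :
    Continuous fun q : (Fin n → ℝ) × ℝ => Real.exp (-(q.2 * q.1 i)) *
      ∏ l ∈ Finset.univ.erase i, (if l ∈ A then silent (q.1 l) q.2 else 1) := by
  refine Continuous.mul (by fun_prop) (continuous_finsetProd _ fun l _ => ?_)
  split_ifs
  · have hl : Continuous fun q : (Fin n → ℝ) × ℝ => (q.1 l, q.2) := by fun_prop
    exact continuous_silent.comp hl
  · exact continuous_const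

lemma continuous_winProb (A : Finset (Fin n)) (i : Fin n) :
    Continuous fun p : Fin n → ℝ => winProb p A i := by
  unfold winProb
  split_ifs
  · exact intervalIntegral.continuous_parametric_intervalIntegral_of_continuous'
      (continuous_winProb_integrand A i) 0 1
  · exact continuous_const

lemma winProb_nonneg {p : Fin n → ℝ} (hp : ∀ i, 0 ≤ p i) (A : Finset (Fin n)) (i : Fin n) :
    0 ≤ winProb p A i := by
  unfold winProb
  split_ifs
  · refine intervalIntegral.integral_nonneg zero_le_one fun t ht =>
      mul_nonneg (Real.exp_pos _).le (Finset.prod_nonneg fun l _ => ?_)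
    split_ifs
    exacts [silent_nonneg (hp l) ht.1 ht.2, zero_le_one]
  · exact le_rfl

/-- The winning probabilities add up to the probability that some clock rings by time `1`. -/
lemma sum_winProb_le_one {p : Fin n → ℝ} (hp : ∀ i, 0 ≤ p i) (A : Finset (Fin n)) :
    ∑ i, winProb p A i ≤ 1 := by
  let K : Fin n → ℝ → ℝ := fun l t => if l ∈ A then silent (p l) t else 1
  let K' : Fin n → ℝ → ℝ := fun l t => if l ∈ A then -Real.exp (-(t * p l)) else 0
  have hK : ∀ l t, HasDerivAt (K l) (K' l t) t := by
    intro l t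
    by_cases h : l ∈ A
    · simpa only [K, K', h, if_true] using hasDerivAt_silent (p l) t
    · simpa only [K, K', h, if_false] using hasDerivAt_const t (1 : ℝ)
  have hKc : ∀ l, Continuous (K l) := fun l =>
    continuous_iff_continuousAt.2 fun t => (hK l t).continuousAt
  have hK'c : ∀ l, Continuous (K' l) := by
    intro l
    by_cases h : l ∈ A
    · simp only [K', h, if_true]; fun_prop
    · simp only [K', h, if_false]; fun_prop
  have hc : ∀ i, Continuous fun t => (∏ l ∈ Finset.univ.erase i, K l t) * K' i t := fun i =>
    (continuous_finsetProd _ fun l _ => hKc l).mul (hK'c i)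
  have hwin : ∀ i, winProb p A i
      = -∫ t in (0 : ℝ)..1, (∏ l ∈ Finset.univ.erase i, K l t) * K' i t := by
    intro i
    rw [← intervalIntegral.integral_neg]
    by_cases h : i ∈ A
    · simp only [winProb, K, K', h, if_true]
      congr 1
      funext t
      ring
    · simp [winProb, K', h]
  have hftc := intervalIntegral.integral_eq_sub_of_hasDerivAt (a := 0) (b := 1)
    (f := fun t => ∏ l, K l t)
    (f' := fun t => ∑ i, (∏ l ∈ Finset.univ.erase i, K l t) * K' i t)
    (fun t _ => HasDerivAt.fun_finsetProd fun l _ => hK l t)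
    ((continuous_finsetSum _ fun i _ => hc i).intervalIntegrable _ _)
  rw [intervalIntegral.integral_finsetSum fun i _ => (hc i).intervalIntegrable _ _] at hftc
  have h0 : ∏ l, K l 0 = 1 := Finset.prod_eq_one fun l _ => by simp [K, silent_zero]
  have h1 : 0 ≤ ∏ l, K l 1 := Finset.prod_nonneg fun l _ => by
    dsimp only [K]
    split_ifs
    exacts [silent_nonneg (hp l) zero_le_one le_rfl, zero_le_one]
  simp only [hwin, Finset.sum_neg_distrib]
  rw [hftc, h0]
  linarith

lemma one_sub_exp_neg_one_le_integral {c : ℝ} (hc : c ≤ 1) :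
    1 - Real.exp (-1) ≤ ∫ t in (0 : ℝ)..1, Real.exp (-(t * c)) := by
  have h1 : ∫ t in (0 : ℝ)..1, Real.exp (-(t * 1)) = 1 - Real.exp (-1) := by
    have := one_sub_add_mul_silent 1 1
    simp only [silent] at this
    simp only [mul_one] at this ⊢
    linarith
  have hcont : ∀ c : ℝ, Continuous fun t : ℝ => Real.exp (-(t * c)) := fun c => by fun_prop
  rw [← h1]
  refine intervalIntegral.integral_mono_on zero_le_one ((hcont 1).intervalIntegrable _ _)
    ((hcont c).intervalIntegrable _ _) fun t ht => ?_
  exact Real.exp_le_exp.2 (neg_le_neg (mul_le_mul_of_nonneg_left hc ht.1))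

/-! ### Rounding for XOS valuations -/

/-- The bidders who request item `j`. -/
def requesters (S : Fin n → Finset (Fin m)) (j : Fin m) : Finset (Fin n) :=
  Finset.univ.filter fun i => j ∈ S i

/-- If bidder `i` requests item `j`, then, whatever else he requests, he wins it with probability at
least `1 - 1/e`. The function `g` is a weight on his requests that contain `j`. Until time `t`, no
bidder `l ≠ i` has rung with probability `e^{-t p_l}`, independently, so the conditional winning
probability is the integral of `e^{-t ∑ p}`. -/
lemma le_sum_request_winProb (x : ConfigLP n m) (i : Fin n) (j : Fin m)
    {g : Finset (Fin m) → ℝ} (hg : ∀ U, 0 ≤ g U) (hgj : ∀ U, j ∉ U → g U = 0) :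
    (1 - Real.exp (-1)) * ∑ U, request 1 x i U * g U
      ≤ ∑ S : Fin n → Finset (Fin m), (∏ l, request 1 x l (S l)) *
          (g (S i) * winProb (share x j) (requesters S j) i) := by
  set p := share x j with hp
  let φ : ℝ → Fin n → Finset (Fin m) → ℝ := fun t l U => if j ∈ U then silent (p l) t else 1
  have hφ : ∀ t l, ∑ U, request 1 x l U * φ t l U = Real.exp (-(t * p l)) := by
    intro t l
    rw [← one_sub_add_mul_silent, ← Finset.sum_filter_add_sum_filter_not Finset.univ (j ∈ ·)]
    have hin : ∑ U with j ∈ U, request 1 x l U = p l := by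
      rw [sum_request_mem, one_mul]
    have hout : ∑ U with j ∉ U, request 1 x l U = 1 - p l := by
      have h := Finset.sum_filter_add_sum_filter_not Finset.univ (j ∈ ·) (request 1 x l)
      rw [sum_request, hin] at h
      linarith
    rw [← hout, add_comm]
    congr 1
    · refine Finset.sum_congr rfl fun U hU => ?_
      rw [show φ t l U = 1 from if_neg (Finset.mem_filter.1 hU).2, mul_one]
    · rw [← hin, Finset.sum_mul, hin]
      refine Finset.sum_congr rfl fun U hU => ?_
      rw [show φ t l U = silent (p l) t from if_pos (Finset.mem_filter.1 hU).2]
  have hcont : ∀ S : Fin n → Finset (Fin m), Continuous fun t =>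
      (∏ l, request 1 x l (S l)) * (g (S i) *
        (Real.exp (-(t * p i)) * ∏ l ∈ Finset.univ.erase i, φ t l (S l))) := by
    intro S
    have := (continuous_winProb_integrand (requesters S j) i).comp
      ((continuous_const (y := p)).prodMk continuous_id)
    refine continuous_const.mul (continuous_const.mul ?_)
    simpa [requesters, φ, Function.comp_def] using this
  have hterm : ∀ S : Fin n → Finset (Fin m), (∏ l, request 1 x l (S l)) *
        (g (S i) * winProb p (requesters S j) i)
      = ∫ t in (0 : ℝ)..1, (∏ l, request 1 x l (S l)) * (g (S i) *
        (Real.exp (-(t * p i)) * ∏ l ∈ Finset.univ.erase i, φ t l (S l))) := by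
    intro S
    rw [intervalIntegral.integral_const_mul, intervalIntegral.integral_const_mul]
    by_cases h : j ∈ S i
    · simp [winProb, requesters, φ, h]
    · simp [hgj _ h]
  have hswap : ∀ t : ℝ, ∑ S : Fin n → Finset (Fin m), (∏ l, request 1 x l (S l)) * (g (S i) *
        (Real.exp (-(t * p i)) * ∏ l ∈ Finset.univ.erase i, φ t l (S l)))
      = (∑ U, request 1 x i U * g U) * Real.exp (-(t * ∑ l, p l)) := by
    intro t
    have h := sum_prod_mul_prod_erase (request 1 x) (φ t) g i
    simp only [hφ] at h
    have hexp : Real.exp (-(t * ∑ l, p l))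
        = Real.exp (-(t * p i)) * ∏ l ∈ Finset.univ.erase i, Real.exp (-(t * p l)) := by
      rw [Finset.mul_prod_erase Finset.univ (fun l => Real.exp (-(t * p l))) (Finset.mem_univ i),
        ← Real.exp_sum, Finset.mul_sum, Finset.sum_neg_distrib]
    rw [hexp, mul_left_comm, ← h, Finset.mul_sum]
    exact Finset.sum_congr rfl fun S _ => by ring
  simp only [hterm]
  rw [← intervalIntegral.integral_finsetSum fun S _ => (hcont S).intervalIntegrable _ _]
  simp only [hswap]
  rw [intervalIntegral.integral_const_mul, mul_comm]
  refine mul_le_mul_of_nonneg_left (one_sub_exp_neg_one_le_integral (sum_share_le_one x j)) ?_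
  exact Finset.sum_nonneg fun U _ =>
    mul_nonneg (request_nonneg zero_le_one le_rfl x i U) (hg U)

/-- The probability that item `j` goes to the bidder `o`, or to nobody if `o = none`, given the
requests `S`. -/
noncomputable def ownerProb (x : ConfigLP n m) (S : Fin n → Finset (Fin m)) (j : Fin m) :
    Option (Fin n) → ℝ
  | none => 1 - ∑ i, winProb (share x j) (requesters S j) i
  | some i => winProb (share x j) (requesters S j) i

lemma ownerProb_nonneg (x : ConfigLP n m) (S : Fin n → Finset (Fin m)) (j : Fin m)
    (o : Option (Fin n)) : 0 ≤ ownerProb x S j o := by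
  cases o with
  | none => exact sub_nonneg.2 (sum_winProb_le_one (share_nonneg x j) _)
  | some i => exact winProb_nonneg (share_nonneg x j) _ _

lemma sum_ownerProb (x : ConfigLP n m) (S : Fin n → Finset (Fin m)) (j : Fin m) :
    ∑ o, ownerProb x S j o = 1 := by
  rw [Fintype.sum_option]
  simp [ownerProb]

lemma continuous_ownerProb (S : Fin n → Finset (Fin m)) (j : Fin m) (o : Option (Fin n)) :
    Continuous fun x : ConfigLP n m => ownerProb x S j o := by
  have h := fun i => (continuous_winProb (requesters S j) i).comp (continuous_share (n := n) j)
  cases o with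
  | none => exact continuous_const.sub (continuous_finsetSum _ fun i _ => h i)
  | some i => exact h i

/-- The owners of the items being drawn independently, item `j` goes to bidder `i` with the
probability prescribed for that item. -/
lemma sum_prod_ownerProb_of_eq (x : ConfigLP n m) (S : Fin n → Finset (Fin m)) (j : Fin m)
    (i : Fin n) : ∑ o : Fin m → Option (Fin n), (∏ j', ownerProb x S j' (o j')) *
      (if o j = some i then 1 else 0) = winProb (share x j) (requesters S j) i := by
  have h := sum_prod_mul_prod_erase (ownerProb x S) (fun _ _ => 1)
    (fun o => if o = some i then 1 else 0) j
  simpa [sum_ownerProb, ownerProb] using h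

/-- Sample a request from each bidder and give every item to one of its requesters by the
clocks that define `winProb`. A bidder keeps each item of his request with probability at
least `1 - 1/e`, hence that fraction of the value of an additive function supporting
his valuation. -/
theorem exists_rounding_XOS (n m : ℕ) :
    ∃ (r : Kernel (ConfigLP n m) (Allocation n m)) (_ : IsMarkovKernel r),
      IsObliviousRounding (XOS m) (Real.exp 1 / (Real.exp 1 - 1)) r := by
  have he : 1 < Real.exp 1 := Real.one_lt_exp_iff.2 one_pos
  let W : ConfigLP n m → (Fin n → Finset (Fin m)) × (Fin m → Option (Fin n)) → ℝ :=
    fun x ω => (∏ l, request 1 x l (ω.1 l)) * ∏ j, ownerProb x ω.1 j (ω.2 j)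
  have hW : ∀ ω, Measurable fun x => W x ω := fun ω =>
    ((continuous_finsetProd _ fun l _ => continuous_request _ l (ω.1 l)).mul
      (continuous_finsetProd _ fun j _ => continuous_ownerProb ω.1 j (ω.2 j))).measurable
  have hreq0 : ∀ (x : ConfigLP n m) (S : Fin n → Finset (Fin m)),
      0 ≤ ∏ l, request 1 x l (S l) := fun x S =>
    Finset.prod_nonneg fun l _ => request_nonneg zero_le_one le_rfl x l (S l)
  have h0 : ∀ x ω, 0 ≤ W x ω := fun x ω =>
    mul_nonneg (hreq0 x ω.1) (Finset.prod_nonneg fun j _ => ownerProb_nonneg x ω.1 j (ω.2 j))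
  have h1 : ∀ x, ∑ ω, W x ω = 1 := by
    intro x
    simp only [W, Fintype.sum_prod_type, ← Finset.mul_sum, ← Fintype.prod_sum, sum_ownerProb,
      Finset.prod_const_one, mul_one]
    exact Finset.prod_eq_one fun l _ => sum_request 1 x l
  refine ⟨kernelOfWeights W hW fun ω => ⟨ω.2⟩, isMarkovKernel_kernelOfWeights W hW _ h0 h1,
    isObliviousRounding_kernelOfWeights W hW _ h0 ?_ fun x i w hw => ?_⟩
  · rw [one_le_div (by linarith)]
    linarith
  choose a haU ha using fun U => XOS.exists_support hw U
  let g : Fin m → Finset (Fin m) → ℝ := fun j U => if j ∈ U then (a U j : ℝ) else 0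
  have hg0 : ∀ j U, 0 ≤ g j U := by
    intro j U
    dsimp only [g]
    split_ifs
    exacts [NNReal.coe_nonneg _, le_rfl]
  have hgsum : ∀ U, (w U : ℝ) = ∑ j, g j U := by
    intro U
    rw [haU, NNReal.coe_sum]
    simp [g]
  have hbundle : ∀ (S : Fin n → Finset (Fin m)) (o : Fin m → Option (Fin n)),
      ∑ j, g j (S i) * (if o j = some i then 1 else 0)
        ≤ w ((⟨o⟩ : Allocation n m).bundle i) := by
    intro S o
    refine le_trans ?_ (NNReal.coe_le_coe.2 (ha (S i) ((⟨o⟩ : Allocation n m).bundle i)))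
    rw [NNReal.coe_sum, Allocation.bundle, Finset.sum_filter]
    refine Finset.sum_le_sum fun j _ => ?_
    dsimp only [g]
    split_ifs <;> simp
  have hmain : (1 - Real.exp (-1)) * (fracValue w i x : ℝ)
      ≤ ∑ ω, W x ω * w ((⟨ω.2⟩ : Allocation n m).bundle i) := by
    have hc : 0 ≤ 1 - Real.exp (-1) := sub_nonneg.2 (Real.exp_le_one_iff.2 (by norm_num))
    calc (1 - Real.exp (-1)) * (fracValue w i x : ℝ)
        = ∑ j, (1 - Real.exp (-1)) * ∑ U, 1 * x.1 i U * g j U := by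
          simp only [fracValue, NNReal.coe_sum, NNReal.coe_mul, hgsum, Finset.mul_sum,
            Finset.sum_mul]
          rw [Finset.sum_comm]
          exact Finset.sum_congr rfl fun T _ => Finset.sum_congr rfl fun U _ => by ring
      _ ≤ ∑ j, (1 - Real.exp (-1)) * ∑ U, request 1 x i U * g j U := by
          refine Finset.sum_le_sum fun j _ => mul_le_mul_of_nonneg_left ?_ hc
          exact Finset.sum_le_sum fun U _ =>
            mul_le_mul_of_nonneg_right (le_request le_rfl x i U) (hg0 j U)
      _ ≤ ∑ j, ∑ S : Fin n → Finset (Fin m), (∏ l, request 1 x l (S l)) *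
            (g j (S i) * winProb (share x j) (requesters S j) i) :=
          Finset.sum_le_sum fun j _ => le_sum_request_winProb x i j (hg0 j) fun U hU => if_neg hU
      _ = ∑ ω, W x ω * ∑ j, g j (ω.1 i) * (if ω.2 j = some i then 1 else 0) := by
          rw [Fintype.sum_prod_type, Finset.sum_comm]
          refine Finset.sum_congr rfl fun S _ => ?_
          simp only [← sum_prod_ownerProb_of_eq, Finset.mul_sum, W]
          rw [Finset.sum_comm]
          exact Finset.sum_congr rfl fun o _ => Finset.sum_congr rfl fun j _ => by ring
      _ ≤ _ := Finset.sum_le_sum fun ω _ =>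
          mul_le_mul_of_nonneg_left (hbundle ω.1 ω.2) (h0 x ω)
  rw [div_mul_eq_mul_div, le_div_iff₀ (by linarith)]
  have := mul_le_mul_of_nonneg_left hmain (Real.exp_pos 1).le
  have hexp : Real.exp 1 * (1 - Real.exp (-1)) = Real.exp 1 - 1 := by
    rw [mul_sub, ← Real.exp_add]
    simp
  rw [← mul_assoc, hexp] at this
  linarith

lemma IsObliviousRounding.mono {α β : ℝ} {r : Kernel (ConfigLP n m) (Allocation n m)}
    (h : IsObliviousRounding C α r) (hαβ : α ≤ β) : IsObliviousRounding C β r :=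
  ⟨h.1.trans hαβ, fun x i w hw => (h.2 x i w hw).trans (by gcongr)⟩

end CombAuction

theorem mainTheorem9 :
    (∀ n m : ℕ, ∃ M : CombAuction.Mechanism n m (CombAuction.XOS m),
      CombAuction.IsPayYourBidObliviousRounding (Real.exp 1 / (Real.exp 1 - 1)) M ∧
      M.PoA ≤ ENNReal.ofReal (4 * (Real.exp 1 / (Real.exp 1 - 1))) ∧
      M.BPoA ≤ ENNReal.ofReal (4 * (Real.exp 1 / (Real.exp 1 - 1)))) ∧
    (∃ c : ℝ, ∀ k : ℕ, 1 ≤ k → ∀ n m : ℕ,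
      ∃ M : CombAuction.Mechanism n m (CombAuction.MPH m k),
        CombAuction.IsPayYourBidObliviousRounding (c * k) M ∧
        M.PoA ≤ ENNReal.ofReal (c * (k : ℝ) ^ 2) ∧
        M.BPoA ≤ ENNReal.ofReal (c * (k : ℝ) ^ 2)) := by
  -- for MPH-`k`, `α = 4k` gives the bound `2 (k + 1) * 4k ≤ 16 k ^ 2`
  refine ⟨fun n m => ?_, 16, fun k hk n m => ?_⟩
  · obtain ⟨f', hf'⟩ := CombAuction.exists_isExactSolver n (CombAuction.XOS m)
    obtain ⟨r, hr, hround⟩ := CombAuction.exists_rounding_XOS n m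
    have hB := CombAuction.BPoA_le_of_rounding hf' hround CombAuction.XOS_subset_MPH_one
      fun _ => CombAuction.halve_mem_XOS
    have hconst : 2 * (((1 : ℕ) : ℝ) + 1) * (Real.exp 1 / (Real.exp 1 - 1))
        = 4 * (Real.exp 1 / (Real.exp 1 - 1)) := by norm_num
    rw [hconst] at hB
    exact ⟨_, ⟨f', hf', r, hr, hround, rfl⟩,
      (CombAuction.Mechanism.PoA_le_BPoA _).trans hB, hB⟩
  · obtain ⟨f', hf'⟩ := CombAuction.exists_isExactSolver n (CombAuction.MPH m k)
    obtain ⟨r, hr, hround⟩ := CombAuction.exists_rounding_MPH n m hk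
    have hk' : (1 : ℝ) ≤ k := by exact_mod_cast hk
    have hB := (CombAuction.BPoA_le_of_rounding hf' hround subset_rfl
      fun _ => CombAuction.halve_mem_MPH).trans
      (ENNReal.ofReal_le_ofReal (by nlinarith : 2 * ((k : ℝ) + 1) * (4 * k) ≤ 16 * (k : ℝ) ^ 2))
    exact ⟨_, ⟨f', hf', r, hr, hround.mono (by linarith), rfl⟩,
      (CombAuction.Mechanism.PoA_le_BPoA _).trans hB, hB⟩
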